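/- Let $n\geq 3$ be an integer and let $K$ be an algebraically closed field of characteristic zero. Let $$f(x_1,x_2,x_3,x_4)=\sum_{\sigma\in S_4}\alpha_\sigma\, x_{\sigma(1)}x_{\sigma(2)}x_{\sigma(3)}x_{\sigma(4)},\qquad \alpha_\sigma\in K,$$ be a nonzero multilinear polynomial in the free associative algebra $K\langle x_1,x_2,x_3,x_4\rangle$. Then the image of $f$ on the matrix algebra $M_n(K)$, that is, the set $\{f(A_1,A_2,A_3,A_4) : A_1,\dots,A_4\in M_n(K)\}$, contains $sl_n(K)$, the set of all $n\times n$ matrices over $K$ with trace zero. -/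

import Mathlib

/-- A polynomial in the noncommuting variables `x_0, …, x_{m-1}` is multilinear if it is a linear
combination of the monomials `x_{σ(0)} ⋯ x_{σ(m-1)}`, where `σ` is a permutation. -/
def IsMultilinearPoly {K : Type*} [CommSemiring K] {m : ℕ} (f : FreeAlgebra K (Fin m)) : Prop :=
  ∃ α : Equiv.Perm (Fin m) → K,
    f = ∑ σ : Equiv.Perm (Fin m), α σ • (List.ofFn fun i => FreeAlgebra.ι K (σ i)).prod

/-- The image of a noncommutative polynomial on an algebra `A`: the set of all values
`f(a_0, …, a_{m-1})` with `a_i ∈ A`. -/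
def polyImage {K : Type*} [CommSemiring K] {m : ℕ} (f : FreeAlgebra K (Fin m))
    (A : Type*) [Semiring A] [Algebra K A] : Set A :=
  Set.range fun a : Fin m → A => FreeAlgebra.lift K a f

/-! The image of `f` is closed under conjugation, and in characteristic zero a traceless matrix is
conjugate to a hollow one, so the target may be put into any convenient conjugate form. Let `α` be
the coefficients of `f`.

Suppose first that `α` is not antisymmetric under exchanging the last two positions, or, after
transposing, the first two. Put diagonal matrices for all variables but one. The value multiplies
each off-diagonal entry of the remaining variable by a polynomial in the diagonal entries. The
failure of antisymmetry makes these polynomials nonzero, so every hollow matrix is a value.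

Otherwise `f` is a combination of the six products `[x_i, x_j][x_k, x_l]`. Making two variables
equal leaves `s[x, y][x, z] + t[x, z][x, y]`. If four such identifications all give zero, `f` is a
multiple of the standard polynomial `s4`. Two polynomials remain.

For `[x, y][x, z] - ω[x, z][x, y]` with `ω ≠ 1`, take `x` diagonal with distinct entries: its
commutators are all hollow matrices, and `A = UV - ωVU` is solved with `U` a permutation matrix,
extended by zero if necessary (`exists_isHollow_perm`). For `ω = 1`, write a suitable triangular
form as `A = [N, V]` with `N` the nilpotent shift, and choose a weighted shift `x` such that both
`N` and `V` minus a scalar are commutators with `x`.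

For `s4`, a hollow matrix is cut into blocks, the first of size 3. If the diagonal blocks are
values, and the first comes from `a, b, c` with `s3 a b c` invertible, then the whole matrix is a
value for any off-diagonal blocks (`exists_s4_fromBlocks`). All traceless 3 × 3 matrices qualify.
Induction does the rest except for size 5, where the remaining 2 × 2 block is an obstacle because
`s4` vanishes on 2 × 2 matrices. There a basis is chosen that makes this block zero, unless the
matrix is a scalar plus rank at most one, which is handled explicitly. -/

open Matrix

namespace Matrix

/-! ### Conjugation of matrices. -/

section Conj

variable {K ι κ : Type*} [Field K] [Fintype ι] [DecidableEq ι] [Fintype κ] [DecidableEq κ]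

theorem isConj_of_mul_eq {P A B : Matrix ι ι K} (hP : IsUnit P) (h : P * A = B * P) :
    IsConj A B := by
  obtain ⟨u, rfl⟩ := hP
  exact ⟨u, h⟩

theorem isConj_iff_exists {A B : Matrix ι ι K} :
    IsConj A B ↔ ∃ P Q : Matrix ι ι K, P * Q = 1 ∧ Q * P = 1 ∧ B = P * A * Q := by
  constructor
  · rintro ⟨u, hu⟩
    refine ⟨u, ↑u⁻¹, u.mul_inv, u.inv_mul, ?_⟩
    rw [hu.eq, mul_assoc, u.mul_inv, mul_one]
  · rintro ⟨P, Q, h1, h2, rfl⟩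
    refine ⟨⟨P, Q, h1, h2⟩, ?_⟩
    change P * A = P * A * Q * P
    rw [mul_assoc, h2, mul_one]

theorem trace_eq_of_isConj {A B : Matrix ι ι K} (h : IsConj A B) : B.trace = A.trace := by
  obtain ⟨P, Q, -, h2, rfl⟩ := isConj_iff_exists.1 h
  rw [trace_mul_comm, ← mul_assoc, h2, one_mul]

theorem isConj_submatrix_perm (A : Matrix ι ι K) (σ : Equiv.Perm ι) :
    IsConj A (A.submatrix σ σ) := by
  refine isConj_iff_exists.2 ⟨(1 : Matrix ι ι K).submatrix σ id,
    (1 : Matrix ι ι K).submatrix id σ, ?_, ?_, ?_⟩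
  · ext i j
    simp [mul_apply, one_apply]
  · ext i j
    simp [mul_apply, one_apply, σ.eq_symm_apply.symm]
  · ext i j
    simp [mul_apply, one_apply]

theorem isConj_reindex {A B : Matrix ι ι K} (e : ι ≃ κ) (h : IsConj A B) :
    IsConj (reindex e e A) (reindex e e B) :=
  (reindexAlgEquiv K K e).toAlgHom.toMonoidHom.map_isConj h

theorem exists_isConj_transvection (A : Matrix ι ι K) {i j : ι} (hij : i ≠ j) (t : K) :
    ∃ B, IsConj A B ∧ ∀ k l, B k l = (A k l + if k = i then t * A j l else 0) -
      if l = j then t * (A k i + if k = i then t * A j i else 0) else 0 := by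
  refine ⟨transvection i j t * A * transvection i j (-t), isConj_iff_exists.2
    ⟨_, _, ?_, ?_, rfl⟩, ?_⟩
  · simp [transvection_mul_transvection_same i j hij]
  · simp [transvection_mul_transvection_same i j hij]
  · intro k l
    have h1 : ∀ l, (transvection i j t * A) k l = A k l + if k = i then t * A j l else 0 := by
      intro l
      split_ifs with h
      · subst h; simp
      · simp [transvection_mul_apply_of_ne, h]
    by_cases h : l = j
    · subst h
      rw [mul_transvection_apply_same, h1, h1, if_pos rfl]
      ring
    · rw [mul_transvection_apply_of_ne _ _ _ _ h, h1, if_neg h, sub_zero]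

theorem exists_isConj_fromBlocks {A B : Matrix ι ι K} (h : IsConj A B) (b : Matrix ι κ K)
    (c : Matrix κ ι K) (d : Matrix κ κ K) :
    ∃ (b' : Matrix ι κ K) (Q : Matrix ι ι K),
      IsConj (fromBlocks A b c d) (fromBlocks B b' (c * Q) d) := by
  obtain ⟨P, Q, h1, h2, rfl⟩ := isConj_iff_exists.1 h
  refine ⟨P * b, Q, isConj_iff_exists.2 ⟨fromBlocks P 0 0 1, fromBlocks Q 0 0 1, ?_, ?_, ?_⟩⟩ <;>
  simp [fromBlocks_multiply, h1, h2]

/-- Conjugate by a block diagonal matrix with last block 1. This is the inductive step for the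
hollow and triangular normal forms. -/
theorem exists_isConj_of_castSucc {n : ℕ} (A : Matrix (Fin (n + 1)) (Fin (n + 1)) K)
    {B' : Matrix (Fin n) (Fin n) K} (h : IsConj (A.submatrix Fin.castSucc Fin.castSucc) B') :
    ∃ B, IsConj A B ∧ B.submatrix Fin.castSucc Fin.castSucc = B' ∧
      B (Fin.last n) (Fin.last n) = A (Fin.last n) (Fin.last n) ∧
      ((∀ j, A (Fin.last n) (Fin.castSucc j) = 0) → ∀ j, B (Fin.last n) (Fin.castSucc j) = 0) := by
  let e : Fin n ⊕ Fin 1 ≃ Fin (n + 1) := finSumFinEquiv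
  have e1 : ∀ j, e (Sum.inl j) = Fin.castSucc j := fun j => rfl
  have e2 : ∀ j, e (Sum.inr j) = Fin.last n := fun j => by
    ext; simp [e]
  have e1' : ∀ j : Fin n, e.symm (Fin.castSucc j) = Sum.inl j := fun j => by
    rw [← e1, Equiv.symm_apply_apply]
  have e2' : e.symm (Fin.last n) = Sum.inr 0 := by rw [← e2 0, Equiv.symm_apply_apply]
  set A1 := reindex e.symm e.symm A with hA1
  have hA : A1 = fromBlocks A1.toBlocks₁₁ A1.toBlocks₁₂ A1.toBlocks₂₁ A1.toBlocks₂₂ :=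
    (fromBlocks_toBlocks _).symm
  have h11 : A1.toBlocks₁₁ = A.submatrix Fin.castSucc Fin.castSucc := by
    ext i j; simp [toBlocks₁₁, hA1, e1]
  rw [← h11] at h
  obtain ⟨b', Q, hb⟩ := exists_isConj_fromBlocks h A1.toBlocks₁₂ A1.toBlocks₂₁ A1.toBlocks₂₂
  rw [← hA] at hb
  refine ⟨reindex e e (fromBlocks B' b' (A1.toBlocks₂₁ * Q) A1.toBlocks₂₂), ?_, ?_, ?_, ?_⟩
  · have := isConj_reindex e hb
    have hAA : reindex e e A1 = A := by ext i j; simp [hA1]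
    rwa [hAA] at this
  · ext i j; simp [e1']
  · simp [e2', hA1, toBlocks₂₂, e2]
  · intro h0 j
    have : A1.toBlocks₂₁ = 0 := by
      ext i j; simp [toBlocks₂₁, hA1, e2, e1, h0]
    simp [e2', e1', this]

end Conj

/-! ### Traceless matrices are conjugate to hollow ones. -/

section Hollow

variable {K ι : Type*} [Field K] [Fintype ι] [DecidableEq ι]

/-- A matrix is hollow if all its diagonal entries vanish. -/
def IsHollow {ι : Type*} (A : Matrix ι ι K) : Prop := ∀ i, A i i = 0

theorem eq_scalar_or_exists_isConj_apply_ne_zero (A : Matrix ι ι K) :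
    (∃ a, A = scalar ι a) ∨ ∃ B, IsConj A B ∧ ∃ i j, i ≠ j ∧ B i j ≠ 0 := by
  by_cases h : ∃ i j, i ≠ j ∧ A i j ≠ 0
  · exact .inr ⟨A, IsConj.refl _, h⟩
  push Not at h
  by_cases h' : ∃ i j, A i i ≠ A j j
  · obtain ⟨i, j, hij⟩ := h'
    have hne : i ≠ j := by rintro rfl; exact hij rfl
    obtain ⟨B, hB, hB'⟩ := exists_isConj_transvection A hne 1
    refine .inr ⟨B, hB, i, j, hne, ?_⟩
    rw [hB', h i j hne, h j i hne.symm]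
    simpa [sub_eq_zero] using hij.symm
  · push Not at h'
    left
    rcases isEmpty_or_nonempty ι with hι | ⟨⟨k⟩⟩
    · exact ⟨0, by ext i; exact hι.elim i⟩
    · refine ⟨A k k, ?_⟩
      ext i j
      by_cases hij : i = j
      · subst hij; simp [h' i k]
      · simp [h i j hij, hij]

/-- A non-scalar matrix has a conjugate with a nonzero off-diagonal entry, and a transvection uses
that entry to clear a diagonal one. -/
theorem eq_scalar_or_exists_isConj_apply_self_eq_zero (A : Matrix ι ι K) (k : ι) :
    (∃ a, A = scalar ι a) ∨ ∃ B, IsConj A B ∧ B k k = 0 := by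
  rcases eq_scalar_or_exists_isConj_apply_ne_zero A with h | ⟨B, hB, i, j, hij, hne⟩
  · exact .inl h
  obtain ⟨C, hC, hC'⟩ := exists_isConj_transvection B hij.symm (-(B j j) / B i j)
  refine .inr ⟨C.submatrix (Equiv.swap k j) (Equiv.swap k j),
    (hB.trans hC).trans (isConj_submatrix_perm _ _), ?_⟩
  simp [hC', hij.symm]
  field_simp
  ring

theorem exists_isConj_isHollow [CharZero K] {n : ℕ} (A : Matrix (Fin n) (Fin n) K)
    (hA : A.trace = 0) : ∃ B, IsConj A B ∧ B.IsHollow := by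
  induction n with
  | zero => exact ⟨A, IsConj.refl _, fun i => i.elim0⟩
  | succ n ih =>
    rcases eq_scalar_or_exists_isConj_apply_self_eq_zero A (Fin.last n) with ⟨a, rfl⟩ | ⟨B, hB, hB0⟩
    · refine ⟨_, IsConj.refl _, fun i => ?_⟩
      have : ((n : K) + 1) * a = 0 := by simpa [trace] using hA
      rcases mul_eq_zero.1 this with h | h
      · exact absurd h (by exact_mod_cast Nat.succ_ne_zero n)
      · simp [h]
    · have htr : (B.submatrix Fin.castSucc Fin.castSucc).trace = 0 := by
        have := trace_eq_of_isConj hB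
        rw [hA, trace, Fin.sum_univ_castSucc] at this
        simpa [trace, hB0] using this
      obtain ⟨C', hC', hC0⟩ := ih _ htr
      obtain ⟨C, hC, h1, h2, -⟩ := exists_isConj_of_castSucc B hC'
      refine ⟨C, hB.trans hC, fun i => ?_⟩
      refine Fin.lastCases ?_ (fun i => ?_) i
      · rw [h2, hB0]
      · have := hC0 i
        rwa [← h1] at this

end Hollow

/-! ### Upper triangular forms with control of some entries. -/

section Triangular

variable {K : Type*} [Field K]

/-- Upper triangular square matrices. -/
def IsUpper {n : ℕ} (A : Matrix (Fin n) (Fin n) K) : Prop := ∀ i j, j < i → A i j = 0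

/-- A left eigenvector for `a` becomes a row of the change of basis. -/
theorem exists_isConj_last_row {n : ℕ} (A : Matrix (Fin (n + 1)) (Fin (n + 1)) K) {a : K}
    (ha : (A - scalar _ a).det = 0) :
    ∃ B, IsConj A B ∧ B (Fin.last n) (Fin.last n) = a ∧
      ∀ j : Fin n, B (Fin.last n) (Fin.castSucc j) = 0 := by
  obtain ⟨v, hv, h⟩ := exists_vecMul_eq_zero_iff.2 ha
  replace h : v ᵥ* A = a • v := by
    rw [vecMul_sub, sub_eq_zero] at h
    rw [h]; simp [← smul_one_eq_diagonal, vecMul_smul]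
  obtain ⟨k, hk⟩ := Function.ne_iff.1 hv
  set P := (1 : Matrix (Fin (n + 1)) (Fin (n + 1)) K).updateRow k v with hP
  have hdet : P.det = v k := by
    rw [hP, ← cramer_transpose_apply, transpose_one, cramer_one]; rfl
  have hu : IsUnit P := by
    rw [isUnit_iff_isUnit_det, hdet]; exact hk.isUnit
  obtain ⟨u, hu⟩ := hu
  set Q : Matrix (Fin (n + 1)) (Fin (n + 1)) K := ↑u⁻¹ with hQ
  have hPQ : P * Q = 1 := by rw [← hu, hQ, u.mul_inv]
  have hQP : Q * P = 1 := by rw [← hu, hQ, u.inv_mul]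
  have hrow : (P * A * Q) k = a • Pi.single k 1 := by
    have h1 : (P * A * Q) k = (P * A) k ᵥ* Q := rfl
    have h2 : (P * A) k = a • P k := by
      have : (P * A) k = P k ᵥ* A := rfl
      rw [this, hP]; simp [h]
    have h3 : P k ᵥ* Q = (P * Q) k := rfl
    rw [h1, h2, smul_vecMul, h3, hPQ]
    ext j; simp [one_apply, Pi.single_apply, eq_comm]
  refine ⟨(P * A * Q).submatrix (Equiv.swap (Fin.last n) k) (Equiv.swap (Fin.last n) k),
    (isConj_iff_exists.2 ⟨P, Q, hPQ, hQP, rfl⟩).trans (isConj_submatrix_perm _ _), ?_, ?_⟩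
  · simp [hrow]
  · intro j
    simp only [submatrix_apply, Equiv.swap_apply_left, hrow, Pi.smul_apply, smul_eq_mul,
      mul_eq_zero]
    right
    rw [Pi.single_apply, if_neg]
    intro hh
    have := congrArg (Equiv.swap (Fin.last n) k) hh
    simp at this

theorem isUpper_of_castSucc {n : ℕ} {A : Matrix (Fin (n + 1)) (Fin (n + 1)) K}
    (h : (A.submatrix Fin.castSucc Fin.castSucc).IsUpper)
    (h' : ∀ j : Fin n, A (Fin.last n) (Fin.castSucc j) = 0) : A.IsUpper := by
  intro i j hij
  induction i using Fin.lastCases with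
  | last =>
    induction j using Fin.lastCases with
    | last => exact absurd hij (lt_irrefl _)
    | cast j => exact h' j
  | cast i =>
    induction j using Fin.lastCases with
    | last => exact absurd hij (Fin.castSucc_lt_last i).not_gt
    | cast j => exact h i j (by simpa using hij)

theorem IsUpper.det_sub_scalar {n : ℕ} {A : Matrix (Fin n) (Fin n) K} (h : A.IsUpper) (i : Fin n) :
    (A - scalar _ (A i i)).det = 0 := by
  rw [det_of_isUpperTriangular]
  · exact Finset.prod_eq_zero (Finset.mem_univ i) (by simp)
  · intro k l hkl
    have hkl' : l < k := hkl
    simp [h k l hkl', hkl'.ne']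

theorem exists_isConj_isUpper [IsAlgClosed K] {n : ℕ} (A : Matrix (Fin n) (Fin n) K) :
    ∃ B, IsConj A B ∧ B.IsUpper := by
  induction n with
  | zero => exact ⟨A, IsConj.refl _, fun i => i.elim0⟩
  | succ n ih =>
    obtain ⟨a, ha⟩ := IsAlgClosed.exists_root A.charpoly (by
      rw [charpoly_degree_eq_dim]; simp; exact_mod_cast Nat.succ_ne_zero n)
    rw [Polynomial.IsRoot, eval_charpoly] at ha
    have ha' : (A - scalar _ a).det = 0 := by
      rw [← neg_sub, det_neg, ha, mul_zero]
    obtain ⟨B, hB, -, hB0⟩ := exists_isConj_last_row A ha'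
    obtain ⟨C', hC', hup⟩ := ih (B.submatrix Fin.castSucc Fin.castSucc)
    obtain ⟨C, hC, h1, -, h2⟩ := exists_isConj_of_castSucc B hC'
    exact ⟨C, hB.trans hC, isUpper_of_castSucc (h1 ▸ hup) (h2 hB0)⟩

/-- An upper triangular form with a prescribed eigenvalue in the last place. -/
theorem exists_isConj_isUpper_last [IsAlgClosed K] {n : ℕ}
    (A : Matrix (Fin (n + 1)) (Fin (n + 1)) K) {a : K} (ha : (A - scalar _ a).det = 0) :
    ∃ B, IsConj A B ∧ B.IsUpper ∧ B (Fin.last n) (Fin.last n) = a := by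
  obtain ⟨B, hB, hBa, hB0⟩ := exists_isConj_last_row A ha
  obtain ⟨C', hC', hup⟩ := exists_isConj_isUpper (B.submatrix Fin.castSucc Fin.castSucc)
  obtain ⟨C, hC, h1, h3, h2⟩ := exists_isConj_of_castSucc B hC'
  exact ⟨C, hB.trans hC, isUpper_of_castSucc (h1 ▸ hup) (h2 hB0), h3.trans hBa⟩

/-- As the trace is zero, the second alternative says that the two longest proper partial sums of
the diagonal are nonzero. This is what `exists_weights` needs. -/
theorem exists_isConj_isUpper_diag [IsAlgClosed K] [CharZero K] {m : ℕ}
    (A : Matrix (Fin (m + 3)) (Fin (m + 3)) K) (hA : A.trace = 0) :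
    ∃ B, IsConj A B ∧ B.IsUpper ∧ (B.IsHollow ∨
      B (Fin.last _) (Fin.last _) ≠ 0 ∧ B (Fin.last _) (Fin.last _) +
        B (Fin.castSucc (Fin.last _)) (Fin.castSucc (Fin.last _)) ≠ 0) := by
  obtain ⟨T, hT, hTup⟩ := exists_isConj_isUpper A
  by_cases h0 : T.IsHollow
  · exact ⟨T, hT, hTup, .inl h0⟩
  simp only [IsHollow, not_forall] at h0
  obtain ⟨i, hi⟩ := h0
  obtain ⟨B, hB, hBa, hB0⟩ := exists_isConj_last_row T (hTup.det_sub_scalar i)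
  set a := T i i with ha
  obtain ⟨S, hS, hSup⟩ := exists_isConj_isUpper (B.submatrix Fin.castSucc Fin.castSucc)
  have htr : S.trace = -a := by
    rw [trace_eq_of_isConj hS]
    have := trace_eq_of_isConj (hT.trans hB)
    rw [hA, trace, Fin.sum_univ_castSucc] at this
    simp only [diag_apply, hBa] at this
    exact eq_neg_of_add_eq_zero_left this
  -- The other `m + 2` eigenvalues sum to `-a`. If each were `-a`, then `(m + 1) a = 0`.
  have hex : ∃ j, S j j ≠ -a := by
    by_contra! hall
    have : S.trace = (m + 2 : ℕ) * (-a) := by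
      simp [trace, hall]
    rw [htr] at this
    have h2 : ((m + 1 : ℕ) : K) * a = 0 := by
      push_cast at this ⊢
      linear_combination this
    rcases mul_eq_zero.1 h2 with h | h
    · exact Nat.succ_ne_zero m (by exact_mod_cast h)
    · exact hi h
  obtain ⟨j, hj⟩ := hex
  obtain ⟨R, hR, hRup, hRl⟩ := exists_isConj_isUpper_last S (hSup.det_sub_scalar j)
  obtain ⟨C, hC, h1, h3, h2⟩ := exists_isConj_of_castSucc B (hS.trans hR)
  refine ⟨C, (hT.trans hB).trans hC, isUpper_of_castSucc (h1 ▸ hRup) (h2 hB0), .inr ⟨?_, ?_⟩⟩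
  · rw [h3, hBa]; exact hi
  · have : C (Fin.castSucc (Fin.last _)) (Fin.castSucc (Fin.last _)) = S j j := by
      rw [← hRl, ← h1]; rfl
    rw [h3, hBa, this]
    intro h
    exact hj (eq_neg_of_add_eq_zero_right h)

/-- An upper triangular form whose top right entry is zero. -/
theorem exists_isConj_isUpper_corner [IsAlgClosed K] {m : ℕ}
    (A : Matrix (Fin (m + 3)) (Fin (m + 3)) K) :
    ∃ B, IsConj A B ∧ B.IsUpper ∧ B 0 (Fin.last _) = 0 := by
  obtain ⟨T, hT, hup⟩ := exists_isConj_isUpper A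
  have h01 : (0 : Fin (m + 3)) ≠ 1 := by simp
  have h1l : (1 : Fin (m + 3)) ≠ Fin.last _ := by
    simp [Fin.ext_iff]
  have h0l : (0 : Fin (m + 3)) ≠ Fin.last _ := by
    simp [Fin.ext_iff]
  have key : ∀ (i j : Fin (m + 3)) (t : K), i < j → ∃ B, IsConj A B ∧ B.IsUpper ∧ ∀ k l,
      B k l = (T k l + if k = i then t * T j l else 0) -
      if l = j then t * (T k i + if k = i then t * T j i else 0) else 0 := by
    intro i j t hij
    obtain ⟨B, hB, hB'⟩ := exists_isConj_transvection T hij.ne t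
    refine ⟨B, hT.trans hB, fun k l hkl => ?_, hB'⟩
    rw [hB', hup k l hkl, hup j i hij]
    by_cases hk : k = i
    · subst hk
      rw [hup j l (hkl.trans hij)]
      simp [(hkl.trans hij).ne]
    · by_cases hl : l = j
      · subst hl; simp [hk, hup k i (hij.trans hkl)]
      · simp [hk, hl]
  -- The corner is cleared by a row operation using `T 1 last`, or else by a column operation using
  -- `T 0 1`. If both are zero, exchanging the indices 0 and 1 keeps the matrix triangular and moves
  -- the zero `T 1 last` into the corner.
  by_cases h1 : T 1 (Fin.last _) = 0
  · by_cases h2 : T 0 1 = 0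
    · refine ⟨_, hT.trans (isConj_submatrix_perm T (Equiv.swap 0 1)), ?_, ?_⟩
      · intro i j hij
        have hj1 : ∀ k : Fin (m + 3), k ≠ 0 → k ≠ 1 → 1 < k := fun k h h' => by
          have e1 : ((1 : Fin (m + 3)) : ℕ) = 1 := rfl
          have e0 : ((0 : Fin (m + 3)) : ℕ) = 0 := rfl
          rw [Ne, Fin.ext_iff] at h h'
          rw [Fin.lt_def]
          omega
        by_cases hi0 : i = 0
        · subst hi0; exact absurd hij (Fin.not_lt_zero j)
        by_cases hi1 : i = 1
        · subst hi1
          have : j = 0 := by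
            rw [Fin.lt_def] at hij; ext; simpa using hij
          subst this; simpa using h2
        · have hi := hj1 i hi0 hi1
          simp only [submatrix_apply, Equiv.swap_apply_of_ne_of_ne hi0 hi1]
          by_cases hj0 : j = 0
          · subst hj0; simpa using hup _ _ hi
          by_cases hj1 : j = 1
          · subst hj1; simpa using hup _ _ (lt_of_le_of_lt (Fin.zero_le _) hi)
          · rw [Equiv.swap_apply_of_ne_of_ne hj0 hj1]; exact hup _ _ hij
      · simp [Equiv.swap_apply_of_ne_of_ne h0l.symm h1l.symm, h1]
    · obtain ⟨B, hB, hBup, hB'⟩ := key 1 (Fin.last _) (T 0 (Fin.last _) / T 0 1)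
        (by simp [Fin.lt_def])
      refine ⟨B, hB, hBup, ?_⟩
      simp [hB', h01, h2]
  · obtain ⟨B, hB, hBup, hB'⟩ := key 0 1 (-T 0 (Fin.last _) / T 1 (Fin.last _)) (by simp)
    refine ⟨B, hB, hBup, ?_⟩
    simp [hB', h1l.symm, h1]

end Triangular

end Matrix

/-! ### The twisted polynomial, for `ω ≠ 1`. -/

namespace Matrix

section AlgHom

variable {K ι : Type*} [Field K] [Fintype ι] [DecidableEq ι]

theorem exists_algHom_of_isConj {A B : Matrix ι ι K} (h : IsConj A B) :
    ∃ φ : Matrix ι ι K →ₐ[K] Matrix ι ι K, φ B = A := by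
  obtain ⟨P, Q, h1, h2, rfl⟩ := isConj_iff_exists.1 h
  refine ⟨AlgHom.ofLinearMap (LinearMap.mulLeft K Q ∘ₗ LinearMap.mulRight K P) ?_ ?_, ?_⟩
  · simp [h2]
  · intro x y
    simp only [LinearMap.comp_apply, LinearMap.mulLeft_apply, LinearMap.mulRight_apply]
    calc Q * (x * y * P) = Q * (x * 1 * y * P) := by rw [mul_one]
      _ = Q * (x * P) * (Q * (y * P)) := by rw [← h1]; noncomm_ring
  · simp only [AlgHom.ofLinearMap_apply, LinearMap.comp_apply, LinearMap.mulLeft_apply,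
      LinearMap.mulRight_apply]
    calc Q * (P * A * Q * P) = (Q * P) * A * (Q * P) := by noncomm_ring
      _ = A := by simp [h2]

end AlgHom

/-- `A` is a value of the polynomial `[x, y][x, z] - ω [x, z][x, y]`. -/
def IsTwistedValue {K R : Type*} [Field K] [Ring R] [Algebra K R] (ω : K) (A : R) : Prop :=
  ∃ x y z : R, A = ⁅x, y⁆ * ⁅x, z⁆ - ω • (⁅x, z⁆ * ⁅x, y⁆)

section Twisted

variable {K ι κ : Type*} [Field K] [Fintype ι] [DecidableEq ι] [Fintype κ] [DecidableEq κ]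

theorem IsTwistedValue.map {R S : Type*} [Ring R] [Algebra K R] [Ring S] [Algebra K S] {ω : K}
    {A : R} (h : IsTwistedValue ω A) (φ : R →ₐ[K] S) : IsTwistedValue ω (φ A) := by
  obtain ⟨x, y, z, rfl⟩ := h
  exact ⟨φ x, φ y, φ z, by simp [Ring.lie_def]⟩

theorem IsTwistedValue.of_isConj {ω : K} {A B : Matrix ι ι K} (hB : IsTwistedValue ω B)
    (h : IsConj A B) : IsTwistedValue ω A := by
  obtain ⟨φ, rfl⟩ := exists_algHom_of_isConj h
  exact hB.map φ

theorem IsTwistedValue.of_reindex {ω : K} {A : Matrix ι ι K} (e : ι ≃ κ)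
    (h : IsTwistedValue ω (reindex e e A)) : IsTwistedValue ω A := by
  have := h.map (reindexAlgEquiv K K e.symm).toAlgHom
  convert this using 1
  ext i j; simp

/-- A hollow matrix is a commutator with any diagonal matrix with distinct entries. -/
theorem IsHollow.exists_lie_diagonal {U : Matrix ι ι K} (hU : U.IsHollow) {d : ι → K}
    (hd : Function.Injective d) : ∃ y, ⁅diagonal d, y⁆ = U := by
  refine ⟨of fun i j => U i j / (d i - d j), ?_⟩
  ext i j
  simp only [Ring.lie_def, sub_apply, diagonal_mul, mul_diagonal, of_apply]
  by_cases h : i = j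
  · subst h; simp [hU i]
  · have : d i - d j ≠ 0 := sub_ne_zero.2 fun h' => h (hd h')
    field_simp

/-- Both factors are commutators with the same diagonal matrix. -/
theorem IsHollow.isTwistedValue [Infinite K] {U V : Matrix ι ι K} (hU : U.IsHollow)
    (hV : V.IsHollow) (ω : K) : IsTwistedValue ω (U * V - ω • (V * U)) := by
  obtain ⟨d⟩ : Nonempty (ι ↪ K) := ⟨(Fintype.equivFin ι).toEmbedding.trans
    (Fin.valEmbedding.trans (Infinite.natEmbedding K))⟩
  obtain ⟨y, rfl⟩ := hU.exists_lie_diagonal d.injective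
  obtain ⟨z, rfl⟩ := hV.exists_lie_diagonal d.injective
  exact ⟨_, y, z, rfl⟩

/-- Solution of a twisted commutator equation with a permutation matrix. -/
theorem exists_isHollow_perm (σ : Equiv.Perm ι) {N : ℕ} (hN : σ ^ N = 1) {ω : K} (hω : ω ^ N ≠ 1)
    {A : Matrix ι ι K} (hA : ∀ i, A (σ i) i = 0) :
    ∃ V : Matrix ι ι K, V.IsHollow ∧
      (1 : Matrix ι ι K).submatrix σ.symm id * V -
        ω • (V * (1 : Matrix ι ι K).submatrix σ.symm id) = A := by
  have hne : 1 - ω ^ N ≠ 0 := sub_ne_zero.2 (Ne.symm hω)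
  -- With `P` the permutation matrix, this is the geometric series `∑ ω^k P^(-k-1) A P^k`, which
  -- telescopes because `P^N = 1`. Its diagonal only involves entries `A (σ i) i`.
  refine ⟨of fun i j => (1 - ω ^ N)⁻¹ *
    ∑ k ∈ Finset.range N, ω ^ k * A ((σ ^ (k + 1)) i) ((σ ^ k) j), ?_, ?_⟩
  · intro i
    simp only [of_apply]
    rw [Finset.sum_eq_zero, mul_zero]
    intro k _
    rw [pow_succ', Equiv.Perm.mul_apply, hA, mul_zero]
  · ext i j
    have h1 : ∀ M : Matrix ι ι K, ((1 : Matrix ι ι K).submatrix σ.symm id * M) i j =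
        M (σ.symm i) j := by
      intro M; simp [mul_apply, one_apply]
    have h2 : ∀ M : Matrix ι ι K, (M * (1 : Matrix ι ι K).submatrix σ.symm id) i j =
        M i (σ j) := by
      intro M; simp [mul_apply, one_apply, Equiv.symm_apply_eq]
    rw [sub_apply, smul_apply, h1, h2]
    simp only [of_apply, smul_eq_mul]
    have e1 : ∀ k, (σ ^ (k + 1)) (σ.symm i) = (σ ^ k) i := fun k => by
      rw [pow_succ, Equiv.Perm.mul_apply, Equiv.apply_symm_apply]
    have e2 : ∀ k, (σ ^ k) (σ j) = (σ ^ (k + 1)) j := fun k => by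
      rw [pow_succ, Equiv.Perm.mul_apply]
    simp only [e1, e2]
    have h3 := Finset.sum_range_sub' (fun k => ω ^ k * A ((σ ^ k) i) ((σ ^ k) j)) N
    simp only [hN, pow_zero, Equiv.Perm.one_apply, one_mul] at h3
    rw [← mul_assoc, mul_comm ω, mul_assoc, ← mul_sub, Finset.mul_sum, ← Finset.sum_sub_distrib]
    have h4 : ∀ k, ω * (ω ^ k * A ((σ ^ (k + 1)) i) ((σ ^ (k + 1)) j)) =
        ω ^ (k + 1) * A ((σ ^ (k + 1)) i) ((σ ^ (k + 1)) j) := fun k => by ring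
    simp only [h4, h3]
    field_simp

theorem isHollow_perm {K ι : Type*} [Field K] [DecidableEq ι] {σ : Equiv.Perm ι} (hσ : ∀ i, σ i ≠ i) :
    ((1 : Matrix ι ι K).submatrix σ.symm id).IsHollow := by
  intro i
  simp [Equiv.symm_apply_eq, (hσ i).symm]

theorem isTwistedValue_of_perm [Infinite K] {σ : Equiv.Perm ι} (hσ : ∀ i, σ i ≠ i) {N : ℕ}
    (hN : σ ^ N = 1) {ω : K} (hω : ω ^ N ≠ 1) {A : Matrix ι ι K} (hA : ∀ i, A (σ i) i = 0) :
    IsTwistedValue ω A := by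
  obtain ⟨V, hV, rfl⟩ := exists_isHollow_perm σ hN hω hA
  exact (isHollow_perm hσ).isTwistedValue hV ω

/-- With `U = diag(P, 0)`, the product `U W` sees only the upper right block of `W`, and `W U` only
the lower left one. Both can therefore be prescribed independently. -/
theorem isTwistedValue_fromBlocks_of_perm [Infinite K] {σ : Equiv.Perm ι} (hσ : ∀ i, σ i ≠ i)
    {N : ℕ} (hN : σ ^ N = 1) {ω : K} (h0 : ω ≠ 0) (hω : ω ^ N ≠ 1) {A : Matrix ι ι K}
    (hA : ∀ i, A (σ i) i = 0) (b : Matrix ι κ K) (c : Matrix κ ι K) :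
    IsTwistedValue ω (fromBlocks A b c 0) := by
  obtain ⟨V, hV, hVA⟩ := exists_isHollow_perm σ hN hω hA
  set P := (1 : Matrix ι ι K).submatrix σ.symm id with hP
  set Q := (1 : Matrix ι ι K).submatrix σ id with hQ
  have hPQ : P * Q = 1 := by
    ext i j
    simp only [hP, hQ, mul_apply, submatrix_apply, one_apply, id]
    rw [Finset.sum_eq_single (σ.symm i)] <;> simp +contextual [eq_comm]
  have hQP : Q * P = 1 := by
    ext i j
    simp only [hP, hQ, mul_apply, submatrix_apply, one_apply, id]
    rw [Finset.sum_eq_single (σ i)] <;> simp +contextual [eq_comm]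
  have hU : (fromBlocks P 0 0 (0 : Matrix κ κ K)).IsHollow := by
    rintro (i | i)
    · exact isHollow_perm hσ i
    · simp
  have hW : (fromBlocks V (Q * b) (-ω⁻¹ • (c * Q)) (0 : Matrix κ κ K)).IsHollow := by
    rintro (i | i)
    · exact hV i
    · simp
  convert hU.isTwistedValue hW ω using 1
  rw [fromBlocks_multiply, fromBlocks_multiply, fromBlocks_smul, sub_eq_add_neg, fromBlocks_neg,
    fromBlocks_add]
  rw [fromBlocks_inj]
  refine ⟨?_, ?_, ?_, ?_⟩
  · simp [← hVA, sub_eq_add_neg]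
  · simp [← Matrix.mul_assoc, hPQ]
  · simp [Matrix.mul_assoc, hQP, smul_smul, h0]
  · simp

/-- The rotation meets the subdiagonal, and the top right corner when it wraps around. -/
theorem IsUpper.apply_finRotate {m : ℕ} {A : Matrix (Fin (m + 1)) (Fin (m + 1)) K} (h : A.IsUpper)
    (h0 : A 0 (Fin.last m) = 0) (i : Fin (m + 1)) : A (finRotate _ i) i = 0 := by
  induction i using Fin.lastCases with
  | last => simpa using h0
  | cast i =>
    apply h
    rw [lt_finRotate_iff_ne_last]
    exact (Fin.castSucc_lt_last i).ne

theorem finRotate_pow_eq_one (m : ℕ) : (finRotate (m + 2)) ^ (m + 2) = 1 := by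
  have h := pow_orderOf_eq_one (finRotate (m + 2))
  rwa [isCycle_finRotate.orderOf, support_finRotate, Finset.card_univ, Fintype.card_fin] at h

theorem finRotate_ne_self (m : ℕ) (i : Fin (m + 2)) : finRotate (m + 2) i ≠ i := by
  rw [← Equiv.Perm.mem_support, support_finRotate]
  exact Finset.mem_univ i

theorem isTwistedValue_of_castSucc_perm [Infinite K] {n : ℕ} {σ : Equiv.Perm (Fin n)}
    (hσ : ∀ i, σ i ≠ i) {N : ℕ} (hN : σ ^ N = 1) {ω : K} (h0 : ω ≠ 0) (hω : ω ^ N ≠ 1)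
    {A : Matrix (Fin (n + 1)) (Fin (n + 1)) K} (hl : A (Fin.last n) (Fin.last n) = 0)
    (hA : ∀ i, A (Fin.castSucc (σ i)) (Fin.castSucc i) = 0) : IsTwistedValue ω A := by
  let e : Fin n ⊕ Fin 1 ≃ Fin (n + 1) := finSumFinEquiv
  have e1 : ∀ j, e (Sum.inl j) = Fin.castSucc j := fun j => rfl
  have e2 : ∀ j, e (Sum.inr j) = Fin.last n := fun j => by ext; simp [e]
  refine IsTwistedValue.of_reindex e.symm ?_
  set A1 := reindex e.symm e.symm A with hA1
  have h22 : A1.toBlocks₂₂ = 0 := by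
    ext i j; simp [toBlocks₂₂, hA1, e2, hl]
  rw [← fromBlocks_toBlocks A1, h22]
  refine isTwistedValue_fromBlocks_of_perm hσ hN h0 hω (fun i => ?_) _ _
  simpa [toBlocks₁₁, hA1, e1] using hA i

/-- A hollow matrix of size three is conjugate to one with a symmetric zero pattern in the
upper left block. -/
theorem IsHollow.exists_isConj_iff {A : Matrix (Fin 3) (Fin 3) K} (hA : A.IsHollow) :
    ∃ B, IsConj A B ∧ B.IsHollow ∧ (B 0 1 = 0 ↔ B 1 0 = 0) := by
  suffices h : ∃ B, IsConj A B ∧ B.IsHollow ∧ ∃ i j, i ≠ j ∧ (B i j = 0 ↔ B j i = 0) by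
    obtain ⟨B, hB, hB0, i, j, hij, h⟩ := h
    obtain ⟨σ, h0, h1⟩ : ∃ σ : Equiv.Perm (Fin 3), σ 0 = i ∧ σ 1 = j := by
      clear h
      revert i j; decide
    exact ⟨_, hB.trans (isConj_submatrix_perm B σ), fun k => hB0 _, by simpa [h0, h1] using h⟩
  have ht : ∀ (C : Matrix (Fin 3) (Fin 3) K) (i j : Fin 3) (t : K), C.IsHollow → i ≠ j →
      C j i = 0 →
      (∃ k l, k ≠ l ∧ (((C k l + if k = i then t * C j l else 0) -
        if l = j then t * C k i else 0) = 0 ↔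
        ((C l k + if l = i then t * C j k else 0) - if k = j then t * C l i else 0) = 0)) →
      ∃ B, IsConj C B ∧ B.IsHollow ∧ ∃ i j, i ≠ j ∧ (B i j = 0 ↔ B j i = 0) := by
    intro C i j t hC hij hji hkl
    obtain ⟨B, hB, hB'⟩ := exists_isConj_transvection C hij t
    simp only [hji, mul_zero, ite_self, add_zero] at hB'
    refine ⟨B, hB, fun k => ?_, ?_⟩
    · rw [hB', hC k]
      by_cases h1 : k = i
      · subst h1; simp [hji, hij]
      · by_cases h2 : k = j
        · subst h2; simp [h1, hji]
        · simp [h1, h2]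
    · simpa only [hB'] using hkl
  by_cases h : ∃ i j, i ≠ j ∧ (A i j = 0 ↔ A j i = 0)
  · exact ⟨A, IsConj.refl _, hA, h⟩
  -- Now exactly one of any two opposite entries vanishes. In each pattern a single transvection
  -- makes some opposite pair both zero or both nonzero.
  push Not at h
  wlog h01 : A 0 1 ≠ 0 generalizing A
  · have hB := isConj_submatrix_perm A (Equiv.swap 0 1)
    obtain ⟨B, hB1, hB2⟩ := this (A := A.submatrix (Equiv.swap 0 1) (Equiv.swap 0 1))
      (fun i => hA _) (fun i j hij => h _ _ (by simpa using hij)) (by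
        have := h 0 1 (by decide)
        simp only [not_not] at h01
        simpa [h01] using this)
    exact ⟨B, hB.trans hB1, hB2⟩
  have a01 := h 0 1 (by decide)
  have a12 := h 1 2 (by decide)
  have a02 := h 0 2 (by decide)
  have h10 : A 1 0 = 0 := by tauto
  by_cases h12 : A 1 2 = 0
  · have h21 : A 2 1 ≠ 0 := by tauto
    by_cases h02 : A 0 2 = 0
    · have h20 : A 2 0 ≠ 0 := by tauto
      exact ht A 0 1 (A 2 1 / A 2 0) hA (by decide) h10 ⟨1, 2, by decide, by simp [h12, h20]⟩
    · have h20 : A 2 0 = 0 := by tauto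
      exact ht A 2 1 (A 0 1 / A 0 2) hA (by decide) h12 ⟨0, 1, by decide, by simp [h10, h02]⟩
  · have h21 : A 2 1 = 0 := by tauto
    by_cases h02 : A 0 2 = 0
    · have h20 : A 2 0 ≠ 0 := by tauto
      exact ht A 0 1 1 hA (by decide) h10 ⟨0, 2, by decide, by simp [h02, h12, h20]⟩
    · have h20 : A 2 0 = 0 := by tauto
      exact ht A 1 2 (A 0 2 / A 0 1) hA (by decide) h21 ⟨0, 2, by decide, by simp [h01, h20]⟩

/-- Either the matrix is zero or it has the distinct eigenvalues `±s` with `s² = A 0 1 * A 1 0`. The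
equivalence excludes the nilpotent Jordan block. -/
theorem IsHollow.exists_isConj_diagonal_fin_two [IsAlgClosed K] [CharZero K]
    {A : Matrix (Fin 2) (Fin 2) K} (hA : A.IsHollow) (h : A 0 1 = 0 ↔ A 1 0 = 0) :
    ∃ B, IsConj A B ∧ B 0 1 = 0 ∧ B 1 0 = 0 := by
  by_cases h0 : A 0 1 = 0
  · exact ⟨A, IsConj.refl _, h0, h.1 h0⟩
  have h1 : A 1 0 ≠ 0 := fun h' => h0 (h.2 h')
  obtain ⟨s, hs⟩ := IsAlgClosed.exists_pow_nat_eq (A 0 1 * A 1 0) (n := 2) (by norm_num)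
  have hs0 : s ≠ 0 := by
    rintro rfl
    exact mul_ne_zero h0 h1 (by simpa using hs.symm)
  refine ⟨!![s, 0; 0, -s], IsConj.symm (isConj_of_mul_eq
    (P := !![A 0 1, A 0 1; s, -s]) ?_ ?_), by simp, by simp⟩
  · rw [isUnit_iff_isUnit_det, det_fin_two_of, isUnit_iff_ne_zero]
    have : A 0 1 * -s - A 0 1 * s = -(2 * (A 0 1 * s)) := by ring
    rw [this]
    exact neg_ne_zero.2 (mul_ne_zero two_ne_zero (mul_ne_zero h0 hs0))
  · have hA' : A = !![0, A 0 1; A 1 0, 0] := by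
      ext i j; fin_cases i <;> fin_cases j <;> simp [hA 0, hA 1]
    generalize A 0 1 = b at *
    generalize A 1 0 = c at *
    subst hA'
    ext i j; fin_cases i <;> fin_cases j <;> simp [mul_apply] <;> linear_combination hs

/-- The full rotation works unless `ω^n = 1`. In that case `ω^(n-1) ≠ 1`, and the rotation of the
first `n - 1` indices is used on a matrix whose last diagonal entry is zero. For `n = 3` the block
has size 2, where no triangular form with zero corner need exist, so it is diagonalized instead. -/
theorem isTwistedValue_of_trace_eq_zero_of_ne_one [IsAlgClosed K] [CharZero K] {m : ℕ} {ω : K}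
    (hω : ω ≠ 1) {A : Matrix (Fin (m + 3)) (Fin (m + 3)) K} (hA : A.trace = 0) :
    IsTwistedValue ω A := by
  have : Infinite K := IsAlgClosed.instInfinite
  by_cases hn : ω ^ (m + 3) = 1
  · have h0 : ω ≠ 0 := by rintro rfl; simp at hn
    have hn' : ω ^ (m + 2) ≠ 1 := fun h => hω (by rw [pow_succ, h, one_mul] at hn; exact hn)
    obtain ⟨B, hB, hB0⟩ := exists_isConj_isHollow A hA
    cases m with
    | zero =>
      obtain ⟨C, hC, hC0, hC1⟩ := hB0.exists_isConj_iff
      obtain ⟨D', hD', h1, h2⟩ := IsHollow.exists_isConj_diagonal_fin_two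
        (A := C.submatrix Fin.castSucc Fin.castSucc) (fun i => hC0 _) (by simpa using hC1)
      obtain ⟨D, hD, hDD', hDl, -⟩ := exists_isConj_of_castSucc C hD'
      refine IsTwistedValue.of_isConj ?_ ((hB.trans hC).trans hD)
      refine isTwistedValue_of_castSucc_perm (finRotate_ne_self 0) (finRotate_pow_eq_one 0) h0 hn'
        (hDl.trans (hC0 _)) fun i => ?_
      have : D (Fin.castSucc (finRotate 2 i)) (Fin.castSucc i) = D' (finRotate 2 i) i := by
        rw [← hDD']; rfl
      rw [this]
      fin_cases i
      · exact h2
      · exact h1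
    | succ m =>
      obtain ⟨D', hD', hup, h1⟩ := exists_isConj_isUpper_corner
        (B.submatrix Fin.castSucc Fin.castSucc)
      obtain ⟨D, hD, hDD', hDl, -⟩ := exists_isConj_of_castSucc B hD'
      refine IsTwistedValue.of_isConj ?_ (hB.trans hD)
      refine isTwistedValue_of_castSucc_perm (finRotate_ne_self _) (finRotate_pow_eq_one _) h0 hn'
        (hDl.trans (hB0 _)) fun i => ?_
      have := hup.apply_finRotate h1 i
      rwa [← hDD'] at this
  · obtain ⟨B, hB, hup, h1⟩ := exists_isConj_isUpper_corner A
    exact (isTwistedValue_of_perm (finRotate_ne_self _) (finRotate_pow_eq_one _) hn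
      (hup.apply_finRotate h1)).of_isConj hB

end Twisted

end Matrix

/-! ### The twisted polynomial, for `ω = 1`: commutators with weighted shifts. -/

namespace Matrix

section Superdiagonal

variable {K : Type*} [Field K]

/-- The matrix with entries `e i` in the places `(i, i + 1)`. -/
def superdiagonal (n : ℕ) (e : ℕ → K) : Matrix (Fin n) (Fin n) K :=
  of fun i j => if (j : ℕ) = i + 1 then e i else 0

theorem superdiagonal_mul_apply {n : ℕ} (e : ℕ → K) (Z : ℕ → ℕ → K) (i j : Fin n) :
    (superdiagonal n e * (of fun i j => Z i j : Matrix (Fin n) (Fin n) K)) i j =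
      if (i : ℕ) + 1 < n then e i * Z (i + 1) j else 0 := by
  simp only [mul_apply, superdiagonal, of_apply]
  split_ifs with h
  · rw [Finset.sum_eq_single ⟨i + 1, h⟩]
    · simp
    · intro b _ hb
      rw [if_neg, zero_mul]
      intro hb'; exact hb (Fin.ext hb')
    · simp
  · refine Finset.sum_eq_zero fun k _ => ?_
    rw [if_neg, zero_mul]
    have := k.isLt
    omega

theorem mul_superdiagonal_apply {n : ℕ} (e : ℕ → K) (Z : ℕ → ℕ → K) (i j : Fin n) :
    ((of fun i j => Z i j : Matrix (Fin n) (Fin n) K) * superdiagonal n e) i j =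
      if (j : ℕ) = 0 then 0 else Z i (j - 1) * e (j - 1) := by
  have hj := j.isLt
  simp only [mul_apply, superdiagonal, of_apply]
  split_ifs with h
  · refine Finset.sum_eq_zero fun k _ => ?_
    rw [if_neg, mul_zero]
    omega
  · rw [Finset.sum_eq_single ⟨j - 1, by omega⟩]
    · simp only
      rw [if_pos (by omega)]
    · intro b _ hb
      rw [if_neg, mul_zero]
      intro hb'; apply hb; ext; simp only; omega
    · simp

/-- The recursion that solves `[superdiagonal e, Z] = M` row by row. -/
def residual (e : ℕ → K) (M : ℕ → ℕ → K) : ℕ → ℕ → K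
  | 0, j => M 0 j
  | i + 1, 0 => M (i + 1) 0
  | i + 1, j + 1 => M (i + 1) (j + 1) + residual e M i j * (e j / e i)

theorem residual_eq_zero (e : ℕ → K) {M : ℕ → ℕ → K} {c : ℕ} (h : ∀ i j, j + c < i → M i j = 0) :
    ∀ i j, j + c < i → residual e M i j = 0
  | 0, j, hij => absurd hij (by omega)
  | i + 1, 0, hij => by rw [residual, h _ _ hij]
  | i + 1, j + 1, hij => by
    rw [residual, h _ _ hij, residual_eq_zero e h i j (by omega), zero_mul, add_zero]

theorem residual_self {e : ℕ → K} (he : ∀ i, e i ≠ 0) (M : ℕ → ℕ → K) (i : ℕ) :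
    residual e M i i = ∑ k ∈ Finset.range (i + 1), M k k := by
  induction i with
  | zero => simp [residual]
  | succ i ih => rw [residual, ih, div_self (he i), mul_one, Finset.sum_range_succ _ (i + 1),
      add_comm]

theorem mul_residual_succ_self {e : ℕ → K} (he : ∀ i, e i ≠ 0) (M : ℕ → ℕ → K) (i : ℕ) :
    e i * residual e M (i + 1) i = ∑ k ∈ Finset.range (i + 1), e k * M (k + 1) k := by
  induction i with
  | zero => simp [residual]
  | succ i ih =>
    rw [residual, Finset.sum_range_succ, ← ih]
    field_simp [he (i + 1)]
    ring

/-- The solution of `[superdiagonal e, Z] = M` with vanishing first row. -/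
def lieSolution (e : ℕ → K) (M : ℕ → ℕ → K) : ℕ → ℕ → K
  | 0, _ => 0
  | i + 1, j => residual e M i j / e i

/-- Each row of the equation determines the next row of `Z`. The last row has no successor, so its
residual must vanish: `h0` gives this on the diagonal, `h1` just left of it, and `hM` further left.
-/
theorem lie_superdiagonal_lieSolution {n : ℕ} {e : ℕ → K} (he : ∀ i, e i ≠ 0) {M : ℕ → ℕ → K}
    (hM : ∀ i j, j + 1 < i → M i j = 0) (h0 : ∑ k ∈ Finset.range (n + 2), M k k = 0)
    (h1 : ∑ k ∈ Finset.range (n + 1), e k * M (k + 1) k = 0) :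
    ⁅superdiagonal (n + 2) e, (of fun i j => lieSolution e M i j : Matrix (Fin (n + 2)) (Fin (n + 2)) K)⁆ =
      of fun i j : Fin (n + 2) => M i j := by
  ext i j
  rw [Ring.lie_def, sub_apply, superdiagonal_mul_apply, mul_superdiagonal_apply, of_apply]
  have hr : ∀ i j : ℕ, residual e M i j - (if j = 0 then 0 else
      lieSolution e M i (j - 1) * e (j - 1)) = M i j := by
    intro i j
    rcases i with _ | i
    · simp [residual, lieSolution]
    · rcases j with _ | j
      · simp [residual]
      · simp [residual, lieSolution]; ring
  have hlast : ∀ j, j < n + 2 → residual e M (n + 1) j = 0 := by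
    intro j hj
    rcases (by omega : j = n + 1 ∨ j = n ∨ j + 1 < n + 1) with rfl | h | h
    · rw [residual_self he, h0]
    · have := mul_residual_succ_self he M n
      rw [h1] at this
      rw [h]
      exact (mul_eq_zero.1 this).resolve_left (he n)
    · exact residual_eq_zero e hM _ _ h
  rw [← hr i j]
  congr 1
  split_ifs with h
  · rw [lieSolution]; field_simp [he i]
  · have hi : (i : ℕ) = n + 1 := by have := i.isLt; omega
    rw [hi, hlast j j.isLt]

theorem exists_weights [Infinite K] {s : ℕ → K} {m : ℕ}
    (h : (∀ k < m + 2, s k = 0) ∨ s m ≠ 0 ∧ s (m + 1) ≠ 0) :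
    ∃ e : ℕ → K, (∀ i, e i ≠ 0) ∧ ∑ k ∈ Finset.range (m + 2), e k * s k = 0 := by
  classical
  rcases h with h | ⟨h1, h2⟩
  · exact ⟨fun _ => 1, fun _ => one_ne_zero, Finset.sum_eq_zero fun k hk => by
      rw [h k (Finset.mem_range.1 hk), mul_zero]⟩
  set S := ∑ k ∈ Finset.range m, s k with hS
  obtain ⟨t, ht⟩ := Infinite.exists_notMem_finset ({0, -S / s m} : Finset K)
  simp only [Finset.mem_insert, Finset.mem_singleton, not_or] at ht
  -- The last weight solves the linear equation; `t` avoids 0 and the value at which that weight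
  -- would vanish.
  refine ⟨fun k => if k = m then t else if k = m + 1 then (-S - t * s m) / s (m + 1) else 1,
    fun i => ?_, ?_⟩
  · simp only
    split_ifs
    · exact ht.1
    · refine div_ne_zero (fun h => ht.2 ?_) h2
      rw [eq_div_iff h1]; linear_combination -h
    · exact one_ne_zero
  · rw [Finset.sum_range_succ, Finset.sum_range_succ, Finset.sum_congr rfl (g := s)]
    · simp; field_simp; ring
    · intro k hk
      have := Finset.mem_range.1 hk
      simp [show k ≠ m by omega, show k ≠ m + 1 by omega]

/-- Solve `A = [N, V]` for the shift `N`. Then `V` vanishes below its subdiagonal, whose entries are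
the partial sums `s` of the diagonal of `A`. Weights with `∑ e k * s k = 0` make `V - τ` a
commutator with the weighted shift, and `N` is its commutator with a diagonal matrix. -/
theorem isTwistedValue_one_of_isUpper [Infinite K] [CharZero K] {m : ℕ}
    {A : Matrix (Fin (m + 3)) (Fin (m + 3)) K} (htr : A.trace = 0) (hup : A.IsUpper)
    (h : A.IsHollow ∨ A (Fin.last _) (Fin.last _) ≠ 0 ∧ A (Fin.last _) (Fin.last _) +
        A (Fin.castSucc (Fin.last _)) (Fin.castSucc (Fin.last _)) ≠ 0) :
    IsTwistedValue (1 : K) A := by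
  set M : ℕ → ℕ → K := fun i j => if h : i < m + 3 ∧ j < m + 3 then A ⟨i, h.1⟩ ⟨j, h.2⟩ else 0
    with hM
  have hMA : ∀ i j : Fin (m + 3), M i j = A i j := fun i j => by simp [hM]
  have hM0 : ∀ i j, j + 0 < i → M i j = 0 := by
    intro i j hij
    simp only [hM]
    split_ifs with h
    · exact hup _ _ hij
    · rfl
  have hMtr : ∑ k ∈ Finset.range (m + 3), M k k = 0 := by
    rw [Finset.sum_range, ← htr, trace]
    exact Finset.sum_congr rfl fun i _ => hMA i i
  set V := lieSolution (fun _ => (1 : K)) M with hV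
  have hV0 : ∀ i j, j + 1 < i → V i j = 0 := by
    intro i j hij
    rcases i with _ | i
    · rfl
    · rw [hV, lieSolution, residual_eq_zero _ hM0 _ _ (by omega), zero_div]
  set s : ℕ → K := fun k => V (k + 1) k with hs
  have hs' : ∀ k, s k = ∑ l ∈ Finset.range (k + 1), M l l := by
    intro k
    rw [hs]; simp only
    rw [hV, lieSolution, residual_self (fun _ => one_ne_zero), div_one]
  have hl : A (Fin.last _) (Fin.last _) = M (m + 2) (m + 2) := by
    rw [← hMA]; rfl
  have hl' : A (Fin.castSucc (Fin.last _)) (Fin.castSucc (Fin.last _)) = M (m + 1) (m + 1) := by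
    rw [← hMA]; rfl
  obtain ⟨e, he, hes⟩ : ∃ e : ℕ → K, (∀ i, e i ≠ 0) ∧ ∑ k ∈ Finset.range (m + 2), e k * s k = 0 := by
    apply exists_weights
    rcases h with h | ⟨h1, h2⟩
    · left
      intro k hk
      rw [hs']
      refine Finset.sum_eq_zero fun l hl => ?_
      have hl := Finset.mem_range.1 hl
      have := hMA ⟨l, by omega⟩ ⟨l, by omega⟩
      rw [h] at this
      exact this
    · right
      rw [hl] at h1 h2
      rw [hl'] at h2
      rw [hs', hs']
      rw [Finset.sum_range_succ] at hMtr
      constructor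
      · rw [Finset.sum_range_succ] at hMtr
        intro h; apply h2; linear_combination hMtr - h
      · intro h; apply h1; linear_combination hMtr - h
  -- Subtracting `τ` makes `V` traceless without changing `[N, V]`.
  set τ : K := (∑ k ∈ Finset.range (m + 3), V k k) / (m + 3) with hτ
  have hm : (m : K) + 3 ≠ 0 := by exact_mod_cast Nat.succ_ne_zero (m + 2)
  set W : ℕ → ℕ → K := fun i j => V i j - if i = j then τ else 0 with hW
  set z : Matrix (Fin (m + 3)) (Fin (m + 3)) K := of fun i j => lieSolution e W i j with hz
  have hz' : ⁅superdiagonal (m + 3) e, z⁆ = of fun i j : Fin (m + 3) => W i j := by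
    refine lie_superdiagonal_lieSolution he ?_ ?_ ?_
    · intro i j hij
      simp [hW, hV0 i j hij, show i ≠ j by omega]
    · simp only [hW, if_true, Finset.sum_sub_distrib, Finset.sum_const, Finset.card_range, hτ]
      simp
      field_simp
      ring
    · rw [← hes]
      exact Finset.sum_congr rfl fun k _ => by simp [hW, hs]
  have hVA : ⁅superdiagonal (m + 3) (fun _ => (1 : K)),
      (of fun i j => V i j : Matrix (Fin (m + 3)) (Fin (m + 3)) K)⁆ = A := by
    rw [hV, lie_superdiagonal_lieSolution (fun _ => one_ne_zero) (fun i j h => hM0 i j (by omega))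
      hMtr]
    · ext i j; exact hMA i j
    · exact Finset.sum_eq_zero fun k _ => by rw [hM0 _ _ (by omega), mul_zero]
  have hWV : (of fun i j => W i j : Matrix (Fin (m + 3)) (Fin (m + 3)) K) =
      (of fun i j => V i j : Matrix (Fin (m + 3)) (Fin (m + 3)) K) - τ • 1 := by
    ext i j
    simp [hW, one_apply, Fin.ext_iff]
  set y : Matrix (Fin (m + 3)) (Fin (m + 3)) K :=
    diagonal fun i => ∑ k ∈ Finset.range i, (e k)⁻¹ with hy
  have hy' : ⁅superdiagonal (m + 3) e, y⁆ = superdiagonal (m + 3) (fun _ => (1 : K)) := by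
    ext i j
    simp only [Ring.lie_def, sub_apply, hy, mul_diagonal, diagonal_mul, superdiagonal, of_apply]
    split_ifs with h
    · rw [h, Finset.sum_range_succ]
      field_simp [he i]
      ring
    · simp
  refine ⟨superdiagonal (m + 3) e, y, z, ?_⟩
  rw [hy', hz', hWV, one_smul, ← Ring.lie_def, ← hVA]
  simp [Ring.lie_def, mul_sub, sub_mul]

theorem isTwistedValue_of_trace_eq_zero [IsAlgClosed K] [CharZero K] {m : ℕ} (ω : K)
    {A : Matrix (Fin (m + 3)) (Fin (m + 3)) K} (hA : A.trace = 0) : IsTwistedValue ω A := by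
  by_cases hω : ω = 1
  · subst hω
    have : Infinite K := IsAlgClosed.instInfinite
    obtain ⟨B, hB, hup, h⟩ := exists_isConj_isUpper_diag A hA
    exact (isTwistedValue_one_of_isUpper ((trace_eq_of_isConj hB).trans hA) hup h).of_isConj hB
  · exact isTwistedValue_of_trace_eq_zero_of_ne_one hω hA

end Superdiagonal

end Matrix

/-! ### Standard polynomials and block matrices. -/

section StandardPolynomials

variable {R : Type*} [Ring R]

/-- The standard polynomial of degree three. -/
def s3 (a b c : R) : R := a * ⁅b, c⁆ - b * ⁅a, c⁆ + c * ⁅a, b⁆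

/-- The standard polynomial of degree four. -/
def s4 (a b c d : R) : R :=
  ⁅a, b⁆ * ⁅c, d⁆ + ⁅c, d⁆ * ⁅a, b⁆ - (⁅a, c⁆ * ⁅b, d⁆ + ⁅b, d⁆ * ⁅a, c⁆) +
    (⁅a, d⁆ * ⁅b, c⁆ + ⁅b, c⁆ * ⁅a, d⁆)

theorem map_s3 {S : Type*} [Ring S] (φ : R →+* S) (a b c : R) :
    φ (s3 a b c) = s3 (φ a) (φ b) (φ c) := by
  simp [s3, Ring.lie_def]

theorem map_s4 {S : Type*} [Ring S] (φ : R →+* S) (a b c d : R) :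
    φ (s4 a b c d) = s4 (φ a) (φ b) (φ c) (φ d) := by
  simp [s4, Ring.lie_def]

variable {K : Type*} [CommRing K] [Algebra K R]

theorem lie_smul_smul (ε δ : K) (a b : R) : ⁅ε • a, δ • b⁆ = (ε * δ) • ⁅a, b⁆ := by
  simp only [Ring.lie_def, smul_mul_smul_comm, smul_sub, mul_comm δ]

theorem s3_smul (ε : K) (a b c : R) : s3 (ε • a) (ε • b) (ε • c) = ε ^ 3 • s3 a b c := by
  simp only [s3, lie_smul_smul, smul_mul_smul_comm]
  module

theorem s4_smul (ε δ : K) (a b c d : R) :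
    s4 (ε • a) (ε • b) (ε • c) (δ • d) = (ε ^ 3 * δ) • s4 a b c d := by
  simp only [s4, lie_smul_smul, smul_mul_smul_comm]
  module

end StandardPolynomials

section CubicPencil

variable {K E : Type*} [Field K] [AddCommGroup E] [Module K E] [FiniteDimensional K E]

/-- Take `p` to be the determinant of the pencil; it is nonzero at `ε = 0`. -/
theorem LinearMap.exists_polynomial_bijective_pencil (L₀ L₁ L₂ L₃ : E →ₗ[K] E)
    (h : Function.Bijective L₀) : ∃ p : Polynomial K, p ≠ 0 ∧ ∀ ε, p.eval ε ≠ 0 →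
      Function.Bijective (L₀ + ε • L₁ + ε ^ 2 • L₂ + ε ^ 3 • L₃) := by
  classical
  let b := Module.finBasis K E
  let m := fun L : E →ₗ[K] E => (LinearMap.toMatrix b b L).map Polynomial.C
  set p := (m L₀ + (Polynomial.X : Polynomial K) • m L₁ + (Polynomial.X ^ 2 : Polynomial K) • m L₂ +
    (Polynomial.X ^ 3 : Polynomial K) • m L₃).det with hp
  have hev : ∀ ε, p.eval ε = LinearMap.det (L₀ + ε • L₁ + ε ^ 2 • L₂ + ε ^ 3 • L₃) := by
    intro ε
    rw [← LinearMap.det_toMatrix b, ← Polynomial.coe_evalRingHom, hp, RingHom.map_det]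
    congr 1
    ext i j
    simp [m]
    ring
  have hbij : ∀ L : E →ₗ[K] E, Function.Bijective L ↔ LinearMap.det L ≠ 0 := by
    intro L
    rw [← isUnit_iff_ne_zero, ← LinearMap.isUnit_iff_isUnit_det, Module.End.isUnit_iff]
  refine ⟨p, ?_, fun ε hε => (hbij _).2 (hev ε ▸ hε)⟩
  intro h0
  have := hev 0
  rw [h0] at this
  simp at this
  exact (hbij L₀).1 h this.symm

end CubicPencil

namespace Matrix

variable {K ι κ : Type*} [Field K] [Fintype ι] [DecidableEq ι] [Fintype κ] [DecidableEq κ]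

/-- The three matrices in the first arguments act on the off-diagonal block of the fourth one. -/
def s4Pencil (a b c : Matrix ι ι K) (a' b' c' : Matrix κ κ K) (Q : Matrix ι κ K) : Matrix ι κ K :=
  s3 a b c * Q - (⁅a, b⁆ * Q * c' - ⁅a, c⁆ * Q * b' + ⁅b, c⁆ * Q * a') +
    (a * Q * ⁅b', c'⁆ - b * Q * ⁅a', c'⁆ + c * Q * ⁅a', b'⁆) - Q * s3 a' b' c'

theorem s4_fromBlocks (a b c d : Matrix ι ι K) (a' b' c' d' : Matrix κ κ K) (Q : Matrix ι κ K)
    (R : Matrix κ ι K) :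
    s4 (fromBlocks a 0 0 a') (fromBlocks b 0 0 b') (fromBlocks c 0 0 c') (fromBlocks d Q R d') =
      fromBlocks (s4 a b c d) (s4Pencil a b c a' b' c' Q) (s4Pencil a' b' c' a b c R)
        (s4 a' b' c' d') := by
  simp only [s4, s4Pencil, s3, Ring.lie_def, fromBlocks_multiply, sub_eq_add_neg, fromBlocks_neg,
    fromBlocks_add, Matrix.mul_zero, Matrix.zero_mul, add_zero, zero_add, neg_zero, fromBlocks_inj]
  refine ⟨trivial, ?_, ?_, trivial⟩ <;>
  · simp only [Matrix.mul_add, Matrix.add_mul, Matrix.mul_neg, Matrix.neg_mul, neg_add, neg_neg,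
      Matrix.mul_assoc]
    abel

/-- Scaling `a', b', c'` by `ε` and `d'` by `ε⁻³` keeps `s4 a' b' c' d'`. The maps on the
off-diagonal blocks of the fourth argument become cubic in `ε`, with constant terms multiplication
by `± s3 a b c`. For generic `ε` both are bijective, so `B` and `C` are attained. -/
theorem exists_s4_fromBlocks [Infinite K] {a b c d : Matrix ι ι K} (h : IsUnit (s3 a b c))
    (a' b' c' d' : Matrix κ κ K) (B : Matrix ι κ K) (C : Matrix κ ι K) :
    ∃ x y z w, fromBlocks (s4 a b c d) B C (s4 a' b' c' d') = s4 x y z w := by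
  obtain ⟨u, hu⟩ := h
  obtain ⟨v, hu1, hu2⟩ : ∃ v : Matrix ι ι K, s3 a b c * v = 1 ∧ v * s3 a b c = 1 :=
    ⟨↑u⁻¹, by rw [← hu, u.mul_inv], by rw [← hu, u.inv_mul]⟩
  let mul3 : Matrix ι ι K → Matrix κ κ K → Matrix ι κ K →ₗ[K] Matrix ι κ K := fun p q =>
    { toFun := fun Q => p * Q * q
      map_add' := fun Q Q' => by simp [Matrix.mul_add, Matrix.add_mul]
      map_smul' := fun t Q => by simp }
  let mul3' : Matrix κ κ K → Matrix ι ι K → Matrix κ ι K →ₗ[K] Matrix κ ι K := fun p q =>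
    { toFun := fun Q => p * Q * q
      map_add' := fun Q Q' => by simp [Matrix.mul_add, Matrix.add_mul]
      map_smul' := fun t Q => by simp }
  obtain ⟨p, hp, hp'⟩ := LinearMap.exists_polynomial_bijective_pencil (mul3 (s3 a b c) 1)
    (-(mul3 ⁅a, b⁆ c' - mul3 ⁅a, c⁆ b' + mul3 ⁅b, c⁆ a'))
    (mul3 a ⁅b', c'⁆ - mul3 b ⁅a', c'⁆ + mul3 c ⁅a', b'⁆) (-mul3 1 (s3 a' b' c'))
    ⟨fun Q Q' hQ => by
      have := congrArg (v * ·) hQ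
      simpa [mul3, ← Matrix.mul_assoc, hu2] using this,
     fun Q => ⟨v * Q, by simp [mul3, ← Matrix.mul_assoc, hu1]⟩⟩
  obtain ⟨q, hq, hq'⟩ := LinearMap.exists_polynomial_bijective_pencil (-mul3' 1 (s3 a b c))
    (mul3' a' ⁅b, c⁆ - mul3' b' ⁅a, c⁆ + mul3' c' ⁅a, b⁆)
    (-(mul3' ⁅a', b'⁆ c - mul3' ⁅a', c'⁆ b + mul3' ⁅b', c'⁆ a))
    (mul3' (s3 a' b' c') 1)
    ⟨fun Q Q' hQ => by
      have := congrArg (· * v) hQ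
      simpa [mul3', Matrix.mul_assoc, hu1] using this,
     fun Q => ⟨-(Q * v), by simp [mul3', Matrix.mul_assoc, hu2]⟩⟩
  classical
  obtain ⟨ε, hε⟩ := Infinite.exists_notMem_finset (p * q * Polynomial.X).roots.toFinset
  have hε' : (p * q * Polynomial.X).eval ε ≠ 0 := by
    intro h0
    apply hε
    rw [Multiset.mem_toFinset, Polynomial.mem_roots (by simp [hp, hq])]
    exact h0
  simp only [Polynomial.eval_mul, Polynomial.eval_X, mul_ne_zero_iff] at hε'
  obtain ⟨⟨h1, h2⟩, h3⟩ := hε'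
  obtain ⟨Q, hQ⟩ := (hp' ε h1).2 B
  obtain ⟨R, hR⟩ := (hq' ε h2).2 C
  refine ⟨fromBlocks a 0 0 (ε • a'), fromBlocks b 0 0 (ε • b'), fromBlocks c 0 0 (ε • c'),
    fromBlocks d Q R ((ε ^ 3)⁻¹ • d'), ?_⟩
  rw [s4_fromBlocks, fromBlocks_inj]
  refine ⟨rfl, ?_, ?_, ?_⟩
  · rw [← hQ]
    simp only [s4Pencil, s3_smul, lie_smul_smul, mul3, LinearMap.add_apply, LinearMap.smul_apply,
      LinearMap.neg_apply, LinearMap.sub_apply, LinearMap.coe_mk, AddHom.coe_mk, Matrix.mul_smul,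
      Matrix.mul_one, Matrix.one_mul]
    module
  · rw [← hR]
    simp only [s4Pencil, s3_smul, lie_smul_smul, mul3', LinearMap.add_apply, LinearMap.smul_apply,
      LinearMap.neg_apply, LinearMap.sub_apply, LinearMap.coe_mk, AddHom.coe_mk, Matrix.smul_mul,
      Matrix.mul_one, Matrix.one_mul]
    module
  · rw [s4_smul, mul_inv_cancel₀ (pow_ne_zero 3 h3), one_smul]

end Matrix

/-- `A` is a value of the standard polynomial of degree four. -/
def IsS4Value {R : Type*} [Ring R] (A : R) : Prop := ∃ a b c d : R, A = s4 a b c d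

/-- `A` is a value of the standard polynomial of degree four, where the first three arguments have
an invertible standard polynomial of degree three. -/
def IsRegularS4Value {R : Type*} [Ring R] (A : R) : Prop :=
  ∃ a b c d : R, A = s4 a b c d ∧ IsUnit (s3 a b c)

namespace Matrix

section S4Value

variable {K ι κ : Type*} [Field K] [Fintype ι] [DecidableEq ι] [Fintype κ] [DecidableEq κ]

theorem _root_.IsS4Value.map {R S : Type*} [Ring R] [Ring S] {A : R} (h : IsS4Value A)
    (φ : R →+* S) : IsS4Value (φ A) := by
  obtain ⟨a, b, c, d, rfl⟩ := h
  exact ⟨φ a, φ b, φ c, φ d, map_s4 φ a b c d⟩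

theorem _root_.IsS4Value.of_isConj {A B : Matrix ι ι K} (hB : IsS4Value B) (h : IsConj A B) :
    IsS4Value A := by
  obtain ⟨φ, rfl⟩ := exists_algHom_of_isConj h
  exact hB.map φ.toRingHom

theorem _root_.IsS4Value.smul {A : Matrix ι ι K} (h : IsS4Value A) (t : K) :
    IsS4Value (t • A) := by
  obtain ⟨a, b, c, d, rfl⟩ := h
  exact ⟨a, b, c, t • d, by simpa using (s4_smul 1 t a b c d).symm⟩

theorem _root_.IsS4Value.of_reindex {A : Matrix ι ι K} (e : ι ≃ κ)
    (h : IsS4Value (reindex e e A)) : IsS4Value A := by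
  have := h.map (reindexAlgEquiv K K e.symm).toAlgHom.toRingHom
  convert this using 1
  ext i j; simp

theorem _root_.IsRegularS4Value.of_isConj {A B : Matrix ι ι K} (hB : IsRegularS4Value B)
    (h : IsConj A B) : IsRegularS4Value A := by
  obtain ⟨φ, rfl⟩ := exists_algHom_of_isConj h
  obtain ⟨a, b, c, d, rfl, hu⟩ := hB
  refine ⟨φ a, φ b, φ c, φ d, map_s4 φ.toRingHom a b c d, ?_⟩
  have := hu.map φ.toRingHom
  rwa [map_s3] at this

theorem isS4Value_fromBlocks [Infinite K] {A : Matrix ι ι K} {D : Matrix κ κ K}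
    (hA : IsRegularS4Value A) (hD : IsS4Value D) (B : Matrix ι κ K) (C : Matrix κ ι K) :
    IsS4Value (fromBlocks A B C D) := by
  obtain ⟨a, b, c, d, rfl, hu⟩ := hA
  obtain ⟨a', b', c', d', rfl⟩ := hD
  exact exists_s4_fromBlocks hu a' b' c' d' B C

theorem isS4Value_zero : IsS4Value (0 : Matrix ι ι K) := ⟨0, 0, 0, 0, by simp [s4, Ring.lie_def]⟩

end S4Value

/-! ### Traceless 3 × 3 matrices are regular values of `s4`. -/

section FinThree

variable {K : Type*} [Field K]

/-- Every vector of `K³` is a cross product. -/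
theorem exists_dets (α β γ : K) : ∃ z₁ z₂ z₃ y₁ y₂ y₃ : K,
    y₁ * z₂ - z₁ * y₂ = α ∧ y₂ * z₃ - z₂ * y₃ = β ∧ y₃ * z₁ - z₃ * y₁ = γ := by
  by_cases hα : α = 0
  · by_cases hβ : β = 0
    · exact ⟨1, 0, 0, 0, 0, γ, by simp [hα], by simp [hβ], by simp⟩
    · exact ⟨0, 0, 1, -γ, β, 0, by simp [hα], by simp, by simp⟩
  · exact ⟨0, 1, -γ / α, α, 0, -β, by simp, by simp, by field_simp; simp⟩

/-- The equations force `z₁ β + z₂ γ + z₃ α = 0`, so a single nonzero scalar would force `z₁ z₂ z₃ =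
0`; hence the hypothesis. A nonzero product can be moved away from `q` by replacing `z, y` with `2z,
y/2`, which multiplies it by 8. -/
theorem exists_dets_ne [Infinite K] [CharZero K] {α β γ : K}
    (h : (α = 0 ∧ β = 0 ∧ γ = 0) ∨ (α ≠ 0 ∧ β ≠ 0) ∨ (β ≠ 0 ∧ γ ≠ 0) ∨ (γ ≠ 0 ∧ α ≠ 0)) (q : K) :
    ∃ z₁ z₂ z₃ y₁ y₂ y₃ : K, y₁ * z₂ - z₁ * y₂ = α ∧ y₂ * z₃ - z₂ * y₃ = β ∧
      y₃ * z₁ - z₃ * y₁ = γ ∧ z₁ * z₂ * z₃ ≠ q := by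
  classical
  suffices h : ∃ z₁ z₂ z₃ y₁ y₂ y₃ : K, y₁ * z₂ - z₁ * y₂ = α ∧ y₂ * z₃ - z₂ * y₃ = β ∧
      y₃ * z₁ - z₃ * y₁ = γ ∧ z₁ * z₂ * z₃ ≠ 0 by
    obtain ⟨z₁, z₂, z₃, y₁, y₂, y₃, h1, h2, h3, h4⟩ := h
    by_cases hq : z₁ * z₂ * z₃ = q
    · refine ⟨2 * z₁, 2 * z₂, 2 * z₃, y₁ / 2, y₂ / 2, y₃ / 2, ?_, ?_, ?_, ?_⟩
      · linear_combination h1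
      · linear_combination h2
      · linear_combination h3
      · rw [← hq]
        intro h
        apply h4
        linear_combination h / 7
    · exact ⟨z₁, z₂, z₃, y₁, y₂, y₃, h1, h2, h3, hq⟩
  have key : ∀ α β γ : K, α ≠ 0 → β ≠ 0 → ∃ z₁ z₂ z₃ y₁ y₂ y₃ : K, y₁ * z₂ - z₁ * y₂ = α ∧
      y₂ * z₃ - z₂ * y₃ = β ∧ y₃ * z₁ - z₃ * y₁ = γ ∧ z₁ * z₂ * z₃ ≠ 0 := by
    intro α β γ hα hβ
    obtain ⟨t, ht⟩ := Infinite.exists_notMem_finset ({0, -γ / β} : Finset K)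
    simp only [Finset.mem_insert, Finset.mem_singleton, not_or] at ht
    refine ⟨t, 1, (-γ - β * t) / α, α, 0, -β, by simp, by simp, by field_simp; ring, ?_⟩
    refine mul_ne_zero (by simpa using ht.1) (div_ne_zero (fun h => ht.2 ?_) hα)
    rw [eq_div_iff hβ]; linear_combination -h
  rcases h with ⟨rfl, rfl, rfl⟩ | ⟨h1, h2⟩ | ⟨h1, h2⟩ | ⟨h1, h2⟩
  · exact ⟨1, 1, 1, 0, 0, 0, by simp⟩
  · exact key α β γ h1 h2
  · obtain ⟨z₁, z₂, z₃, y₁, y₂, y₃, h⟩ := key β γ α h1 h2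
    exact ⟨z₃, z₁, z₂, y₃, y₁, y₂, h.2.2.1, h.1, h.2.1, by
      rw [show z₃ * z₁ * z₂ = z₁ * z₂ * z₃ by ring]; exact h.2.2.2⟩
  · obtain ⟨z₁, z₂, z₃, y₁, y₂, y₃, h⟩ := key γ α β h1 h2
    exact ⟨z₂, z₃, z₁, y₂, y₃, y₁, h.2.1, h.2.2.1, h.1, by
      rw [show z₂ * z₃ * z₁ = z₁ * z₂ * z₃ by ring]; exact h.2.2.2⟩

/-- Two diagonal and two hollow arguments separate the off-diagonal entries into two independent
cross products, and `s3` of the first three has determinant `z₁ z₂ z₃ - z₁' z₂' z₃'`. -/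
theorem isRegularS4Value_of_dets {z₁ z₂ z₃ y₁ y₂ y₃ z₁' z₂' z₃' y₁' y₂' y₃' : K}
    (h : z₁ * z₂ * z₃ ≠ z₁' * z₂' * z₃') :
    IsRegularS4Value !![0, y₁ * z₂ - z₁ * y₂, -(y₁' * z₂' - z₁' * y₂');
      -(y₂' * z₃' - z₂' * y₃'), 0, y₃ * z₁ - z₃ * y₁;
      y₂ * z₃ - z₂ * y₃, -(y₃' * z₁' - z₃' * y₁'), 0] := by
  refine ⟨!![1, 0, 0; 0, 0, 0; 0, 0, 1], !![0, 0, 0; 0, 1, 0; 0, 0, 1],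
    !![0, z₁', z₁; z₃, 0, z₂'; z₃', z₂, 0], !![0, y₁', y₁; y₃, 0, y₂'; y₃', y₂, 0], ?_, ?_⟩
  · simp only [s4, Ring.lie_def, mul_fin_three, sub_eq_add_neg]
    ext i j
    fin_cases i <;> fin_cases j <;> simp <;> ring
  · rw [isUnit_iff_isUnit_det, isUnit_iff_ne_zero]
    have : (s3 !![1, 0, 0; 0, 0, 0; 0, 0, 1] !![0, 0, 0; 0, 1, 0; 0, 0, 1]
      !![0, z₁', z₁; z₃, 0, z₂'; z₃', z₂, 0]).det = z₁ * z₂ * z₃ - z₁' * z₂' * z₃' := by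
      simp [s3, Ring.lie_def, det_fin_three]
      ring
    rw [this]
    exact sub_ne_zero.2 h

/-- Not exactly one of three scalars is nonzero. -/
def NotLonely (α β γ : K) : Prop :=
  (α = 0 ∧ β = 0 ∧ γ = 0) ∨ (α ≠ 0 ∧ β ≠ 0) ∨ (β ≠ 0 ∧ γ ≠ 0) ∨ (γ ≠ 0 ∧ α ≠ 0)

theorem IsHollow.isRegularS4Value_of_notLonely [Infinite K] [CharZero K]
    {A : Matrix (Fin 3) (Fin 3) K} (hA : A.IsHollow)
    (h : NotLonely (A 0 1) (A 2 0) (A 1 2) ∨ NotLonely (-A 0 2) (-A 1 0) (-A 2 1)) :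
    IsRegularS4Value A := by
  suffices hs : ∃ z₁ z₂ z₃ y₁ y₂ y₃ z₁' z₂' z₃' y₁' y₂' y₃' : K,
      (y₁ * z₂ - z₁ * y₂ = A 0 1 ∧ y₂ * z₃ - z₂ * y₃ = A 2 0 ∧ y₃ * z₁ - z₃ * y₁ = A 1 2) ∧
      (y₁' * z₂' - z₁' * y₂' = -A 0 2 ∧ y₂' * z₃' - z₂' * y₃' = -A 1 0 ∧
        y₃' * z₁' - z₃' * y₁' = -A 2 1) ∧ z₁ * z₂ * z₃ ≠ z₁' * z₂' * z₃' by
    obtain ⟨z₁, z₂, z₃, y₁, y₂, y₃, z₁', z₂', z₃', y₁', y₂', y₃', ⟨h1, h2, h3⟩, ⟨h4, h5, h6⟩, hq⟩ := hs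
    convert isRegularS4Value_of_dets hq using 1
    rw [h1, h2, h3, h4, h5, h6]
    ext i j
    fin_cases i <;> fin_cases j <;> simp [hA 0, hA 1, hA 2]
  rcases h with h | h
  · obtain ⟨z₁', z₂', z₃', y₁', y₂', y₃', h'⟩ := exists_dets (-A 0 2) (-A 1 0) (-A 2 1)
    obtain ⟨z₁, z₂, z₃, y₁, y₂, y₃, h1, h2, h3, h4⟩ := exists_dets_ne h (z₁' * z₂' * z₃')
    exact ⟨z₁, z₂, z₃, y₁, y₂, y₃, z₁', z₂', z₃', y₁', y₂', y₃', ⟨h1, h2, h3⟩, h', h4⟩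
  · obtain ⟨z₁', z₂', z₃', y₁', y₂', y₃', h'⟩ := exists_dets (A 0 1) (A 2 0) (A 1 2)
    obtain ⟨z₁, z₂, z₃, y₁, y₂, y₃, h1, h2, h3, h4⟩ := exists_dets_ne h (z₁' * z₂' * z₃')
    exact ⟨z₁', z₂', z₃', y₁', y₂', y₃', z₁, z₂, z₃, y₁, y₂, y₃, h', ⟨h1, h2, h3⟩, h4.symm⟩

/-- If each triple has exactly one nonzero entry, a transvection preserving hollowness either clears
the one in the second triple or creates another in the first. -/
theorem IsHollow.isRegularS4Value_of_apply_ne_zero [Infinite K] [CharZero K]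
    {A : Matrix (Fin 3) (Fin 3) K} (hA : A.IsHollow) (h01 : A 0 1 ≠ 0) : IsRegularS4Value A := by
  by_cases h : NotLonely (A 0 1) (A 2 0) (A 1 2) ∨ NotLonely (-A 0 2) (-A 1 0) (-A 2 1)
  · exact hA.isRegularS4Value_of_notLonely h
  rw [not_or] at h
  obtain ⟨h, h'⟩ := h
  simp only [NotLonely, neg_eq_zero, ne_eq] at h h'
  have h20 : A 2 0 = 0 := by tauto
  have h12 : A 1 2 = 0 := by tauto
  by_cases h02 : A 0 2 = 0
  · by_cases h10 : A 1 0 = 0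
    · obtain ⟨B, hB, hB'⟩ := exists_isConj_transvection A (i := 2) (j := 0) (by decide)
        (-A 2 1 / A 0 1)
      refine IsRegularS4Value.of_isConj (IsHollow.isRegularS4Value_of_notLonely (fun i => ?_) ?_) hB
      · fin_cases i <;> simp [hB', hA 0, hA 1, hA 2, h02]
      · right; left
        simp [hB', h02, h10, h12, h01]
    · obtain ⟨B, hB, hB'⟩ := exists_isConj_transvection A (i := 0) (j := 2) (by decide) 1
      refine IsRegularS4Value.of_isConj (IsHollow.isRegularS4Value_of_notLonely (fun i => ?_) ?_) hB
      · fin_cases i <;> simp [hB', hA 0, hA 1, hA 2, h20]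
      · have h21 : A 2 1 = 0 := by tauto
        left; right; right; right
        simp [hB', h12, h10, h21, h01]
  · have h10 : A 1 0 = 0 := by tauto
    have h21 : A 2 1 = 0 := by tauto
    obtain ⟨B, hB, hB'⟩ := exists_isConj_transvection A (i := 1) (j := 2) (by decide)
      (A 0 2 / A 0 1)
    refine IsRegularS4Value.of_isConj (IsHollow.isRegularS4Value_of_notLonely (fun i => ?_) ?_) hB
    · fin_cases i <;> simp [hB', hA 0, hA 1, hA 2, h21]
    · right; left
      simp [hB', h21, h10, h20, h01]

theorem IsHollow.isRegularS4Value [Infinite K] [CharZero K]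
    {A : Matrix (Fin 3) (Fin 3) K} (hA : A.IsHollow) : IsRegularS4Value A := by
  have hrot : ∀ σ : Equiv.Perm (Fin 3), A (σ 0) (σ 1) ≠ 0 → IsRegularS4Value A := fun σ h =>
    (isRegularS4Value_of_apply_ne_zero (A := A.submatrix σ σ) (fun i => hA _) h).of_isConj
      (isConj_submatrix_perm A σ)
  by_cases h01 : A 0 1 = 0
  · by_cases h12 : A 1 2 = 0
    · by_cases h20 : A 2 0 = 0
      · exact hA.isRegularS4Value_of_notLonely (.inl (.inl ⟨h01, h20, h12⟩))
      · exact hrot (finRotate 3)⁻¹ h20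
    · exact hrot (finRotate 3) h12
  · exact hA.isRegularS4Value_of_apply_ne_zero h01

theorem isRegularS4Value_of_trace_eq_zero [Infinite K] [CharZero K]
    {A : Matrix (Fin 3) (Fin 3) K} (hA : A.trace = 0) : IsRegularS4Value A := by
  obtain ⟨B, hB, hB0⟩ := exists_isConj_isHollow A hA
  exact hB0.isRegularS4Value.of_isConj hB

end FinThree

end Matrix

/-! ### Endomorphisms of a five-dimensional space. -/

section Pencil

variable {K V : Type*} [Field K] [AddCommGroup V] [Module K V]

/-- If `T` maps every vector outside of `L` into the span of `L` and this vector, then `T` is a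
scalar modulo `L`. -/
theorem LinearMap.exists_sub_smul_mem {T : V →ₗ[K] V} {L : Submodule K V}
    (hL : 1 < Module.finrank K (V ⧸ L)) (h : ∀ w ∉ L, ∃ c : K, T w - c • w ∈ L) :
    ∃ a : K, ∀ x, T x - a • x ∈ L := by
  -- If `T w ∉ L`, choose `x` independent of `T w` modulo `L`. Comparing `h` at `x` and at `w + x`
  -- makes `T w` a multiple of `x` modulo `L`.
  have hTL : ∀ w ∈ L, T w ∈ L := by
    intro w hw
    by_contra hTw
    obtain ⟨x', hx'⟩ : ∃ x' : V ⧸ L, LinearIndependent K ![L.mkQ (T w), x'] := by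
      obtain ⟨x', hx'⟩ := exists_linearIndependent_pair_of_one_lt_finrank hL
        (x := L.mkQ (T w)) (by simpa using hTw)
      exact ⟨x', hx'⟩
    obtain ⟨x, rfl⟩ := L.mkQ_surjective x'
    have hx : x ∉ L := by
      intro hx
      have h0 : L.mkQ x = 0 := by simpa using hx
      exact hx'.ne_zero 1 h0
    have hwx : w + x ∉ L := fun hwx => hx (by simpa using L.sub_mem hwx hw)
    obtain ⟨c, hc⟩ := h x hx
    obtain ⟨c', hc'⟩ := h (w + x) hwx
    have h1 : T w - (c' - c) • x ∈ L := by
      have := L.sub_mem (L.add_mem hc' (L.smul_mem c' hw)) hc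
      convert this using 1
      rw [map_add]; module
    rw [LinearIndependent.pair_iff] at hx'
    have := hx' 1 (-(c' - c)) (by
      rw [← map_smul L.mkQ, ← map_smul L.mkQ, ← map_add L.mkQ]
      simp only [Submodule.mkQ_apply, Submodule.Quotient.mk_eq_zero]
      convert h1 using 1
      module)
    exact one_ne_zero this.1
  obtain ⟨a, ha⟩ := LinearMap.exists_eq_smul_id_of_forall_notLinearIndependent
    (f := L.mapQ L T hTL) (fun v hv => by
      obtain ⟨x, rfl⟩ := L.mkQ_surjective v
      have hx : x ∉ L := by
        intro hx
        have h0 : L.mkQ x = 0 := by simpa using hx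
        exact hv.ne_zero 0 h0
      obtain ⟨c, hc⟩ := h x hx
      rw [LinearIndependent.pair_iff] at hv
      have := hv (-c) 1 (by
        rw [Submodule.mkQ_apply, Submodule.mapQ_apply, one_smul, ← Submodule.Quotient.mk_smul,
          ← Submodule.Quotient.mk_add, Submodule.Quotient.mk_eq_zero]
        convert hc using 1
        module)
      exact one_ne_zero this.2)
  refine ⟨a, fun x => ?_⟩
  have := LinearMap.congr_fun ha (L.mkQ x)
  rw [Submodule.mkQ_apply, Submodule.mapQ_apply, LinearMap.smul_apply, Module.End.one_apply,
    ← Submodule.Quotient.mk_smul] at this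
  exact (Submodule.Quotient.eq L).1 this

/-- If no such `v, w` exist, `T` is a scalar modulo the plane spanned by `v` and `T v`, for every
non-eigenvector `v`. Two different planes of this kind do not span a space of dimension 5, so their
scalars agree, and `T` minus this scalar maps into their intersection, of dimension at most one. -/
theorem LinearMap.exists_linearIndependent_or_rank_one [FiniteDimensional K V]
    (hV : Module.finrank K V = 5) (T : V →ₗ[K] V) {v : V} (hv : LinearIndependent K ![v, T v]) :
    (∃ v w, LinearIndependent K ![v, T v, w, T w]) ∨
      ∃ (a : K) (u : V), ∀ x, ∃ c : K, T x - a • x = c • u := by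
  by_contra! hcon
  obtain ⟨hcon, hcon'⟩ := hcon
  have hdim : ∀ v, Module.finrank K (Submodule.span K {v, T v}) ≤ 2 := by
    intro v
    classical
    refine (finrank_span_le_card _).trans ?_
    simpa using Finset.card_le_two
  have key : ∀ v, LinearIndependent K ![v, T v] →
      ∃ a : K, ∀ x, T x - a • x ∈ Submodule.span K {v, T v} := by
    intro v hv
    apply LinearMap.exists_sub_smul_mem
    · have := Submodule.finrank_quotient_add_finrank (Submodule.span K {v, T v})
      have := hdim v
      omega
    · intro w hw
      have h3 : LinearIndependent K ![v, T v, w] := by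
        have := linearIndependent_finSnoc (v := ![v, T v]) (x := w) |>.2 ⟨hv, by
          simpa [Set.pair_comm] using hw⟩
        convert this using 1
        ext i; fin_cases i <;> rfl
      have h4 : T w ∈ Submodule.span K (Set.range ![v, T v, w]) := by
        by_contra hTw
        refine hcon v w ?_
        have := linearIndependent_finSnoc (v := ![v, T v, w]) (x := T w) |>.2 ⟨h3, hTw⟩
        convert this using 1
        ext i; fin_cases i <;> rfl
      have hr : Set.range ![v, T v, w] = insert w {v, T v} := by
        ext x; simp [eq_comm]; tauto
      rw [hr, Submodule.mem_span_insert] at h4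
      obtain ⟨c, z, hz, hc⟩ := h4
      exact ⟨c, by rw [hc]; simpa using hz⟩
  obtain ⟨a, ha⟩ := key v hv
  set L := Submodule.span K {v, T v} with hL
  have hvL : v ∈ L := Submodule.subset_span (by simp)
  have hne : ∃ w, w ∉ L := by
    by_contra! hall
    have : L = ⊤ := Submodule.eq_top_iff'.2 hall
    have h2 := hdim v
    rw [← hL, this, finrank_top] at h2
    omega
  -- Otherwise everything outside `L` is an eigenvector. Comparing `w` and `w + v` then makes `v` an
  -- eigenvector too.
  obtain ⟨v₁, hv₁L, hv₁⟩ : ∃ v₁ ∉ L, LinearIndependent K ![v₁, T v₁] := by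
    by_contra! hall
    obtain ⟨w, hw⟩ := hne
    have heig : ∀ w ∉ L, ∃ c : K, T w = c • w := by
      intro w hw
      have hw0 : w ≠ 0 := by rintro rfl; exact hw L.zero_mem
      have := hall w hw
      rw [LinearIndependent.pair_iff' hw0] at this
      push Not at this
      obtain ⟨c, hc⟩ := this
      exact ⟨c, hc.symm⟩
    obtain ⟨c, hc⟩ := heig w hw
    obtain ⟨c', hc'⟩ := heig (w + v) (fun h => hw (by simpa using L.sub_mem h hvL))
    have h1 : T v = (c' - c) • w + c' • v := by
      have : T v = T (w + v) - T w := by simp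
      rw [this, hc, hc']; module
    have h2 : c' - c = 0 := by
      by_contra h0
      apply hw
      have h3 : (c' - c) • w ∈ L := by
        have : (c' - c) • w = T v - c' • v := by rw [h1]; module
        rw [this]
        exact L.sub_mem (Submodule.subset_span (by simp)) (L.smul_mem _ hvL)
      exact (L.smul_mem_iff h0).1 h3
    rw [h2, zero_smul, zero_add] at h1
    rw [LinearIndependent.pair_iff] at hv
    have := hv (-c') 1 (by rw [h1]; module)
    exact one_ne_zero this.2
  obtain ⟨a₁, ha₁⟩ := key v₁ hv₁
  set L₁ := Submodule.span K {v₁, T v₁} with hL₁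
  have hdL := hdim v
  have hdL₁ := hdim v₁
  rw [← hL] at hdL
  rw [← hL₁] at hdL₁
  have haa : a = a₁ := by
    by_contra hne
    have htop : L ⊔ L₁ = ⊤ := by
      rw [Submodule.eq_top_iff']
      intro x
      have h1 : (a₁ - a) • x ∈ L ⊔ L₁ := by
        have := (L ⊔ L₁).sub_mem (Submodule.mem_sup_left (ha x)) (Submodule.mem_sup_right (ha₁ x))
        convert this using 1
        module
      exact ((L ⊔ L₁).smul_mem_iff (sub_ne_zero.2 (Ne.symm hne))).1 h1
    have := Submodule.finrank_add_le_finrank_add_finrank L L₁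
    rw [htop, finrank_top] at this
    omega
  subst haa
  have hlt : Module.finrank K ↥(L ⊓ L₁) < Module.finrank K L₁ := by
    apply Submodule.finrank_lt_finrank_of_lt
    refine lt_of_le_of_ne inf_le_right fun h => hv₁L ?_
    have : v₁ ∈ L₁ := Submodule.subset_span (by simp)
    rw [← h] at this
    exact this.1
  obtain ⟨u, hu⟩ := finrank_le_one_iff.1 (show Module.finrank K ↥(L ⊓ L₁) ≤ 1 by omega)
  obtain ⟨x, hx⟩ := hcon' a u
  obtain ⟨c, hc⟩ := hu ⟨_, ha x, ha₁ x⟩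
  exact hx c (by simpa using (congrArg Subtype.val hc).symm)

end Pencil

namespace Matrix

/-! ### Traceless matrices are values of `s4`. -/

section S4

variable {K : Type*} [Field K] [Infinite K] [CharZero K]

theorem isS4Value_of_zero_block {A : Matrix (Fin 5) (Fin 5) K} (hA : A.trace = 0) {i j : Fin 5}
    (hij : i ≠ j) (h1 : A i i = 0) (h2 : A i j = 0) (h3 : A j i = 0) (h4 : A j j = 0) :
    IsS4Value A := by
  obtain ⟨σ, hi, hj⟩ : ∃ σ : Equiv.Perm (Fin 5), σ 3 = i ∧ σ 4 = j := by
    have hj : (3 : Fin 5) ≠ Equiv.swap 3 i j := by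
      intro h
      have := congrArg (Equiv.swap 3 i) h
      simp at this
      exact hij this
    exact ⟨Equiv.swap 3 i * Equiv.swap 4 (Equiv.swap 3 i j), by
      simp [Equiv.swap_apply_of_ne_of_ne (show (3 : Fin 5) ≠ 4 by decide) hj], by simp⟩
  set B := A.submatrix σ σ with hB
  have hAB : IsConj A B := isConj_submatrix_perm A σ
  refine IsS4Value.of_isConj ?_ hAB
  let e : Fin 3 ⊕ Fin 2 ≃ Fin 5 := finSumFinEquiv
  refine IsS4Value.of_reindex e.symm ?_
  set C := reindex e.symm e.symm B with hC
  have h22 : C.toBlocks₂₂ = 0 := by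
    ext k l
    fin_cases k <;> fin_cases l
    · exact (congrArg₂ A hi hi).trans h1
    · exact (congrArg₂ A hi hj).trans h2
    · exact (congrArg₂ A hj hi).trans h3
    · exact (congrArg₂ A hj hj).trans h4
  have htr : C.toBlocks₁₁.trace = 0 := by
    have h := trace_eq_of_isConj hAB
    rw [hA] at h
    have h5 : C.trace = B.trace := by
      simp only [trace, hC, diag_apply, reindex_apply, submatrix_apply, Equiv.symm_symm]
      exact e.sum_comp fun i => B i i
    have h6 : C.trace = C.toBlocks₁₁.trace + C.toBlocks₂₂.trace := Fintype.sum_sum_type _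
    rwa [h6, h, h22, trace_zero, add_zero] at h5
  rw [← fromBlocks_toBlocks C, h22]
  exact isS4Value_fromBlocks (isRegularS4Value_of_trace_eq_zero htr) isS4Value_zero _ _

theorem isS4Value_diagonal_int :
    s4 (diagonal ![1, -1, 1, -1, 0] : Matrix (Fin 5) (Fin 5) ℤ)
      !![0, 1, 0, 0, 0; 0, 0, 0, 0, 0; 0, 0, 0, 1, 0; 0, 0, 0, 0, 0; 0, 0, 0, 0, 0]
      !![0, 0, 0, 0, 0; 0, 0, 1, 0, 0; 0, 0, 0, 0, 0; 0, 0, 0, 0, 1; 0, 0, 0, 0, 0]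
      !![0, 0, 0, 0, 0; 0, 0, 0, 0, 0; 1, 0, 0, 0, 0; 0, 1, 0, 0, 0; 0, 0, 4, 0, 0] =
    diagonal ![2, 2, 2, 2, -8] := by
  simp only [s4, Ring.lie_def]
  decide

/-- The matrix is conjugate to `diag(1, 1, 1, 1, -4)`, half of the explicit integral value. -/
theorem isS4Value_one_sub_ones {K : Type*} [Field K] [CharZero K] :
    IsS4Value ((1 : Matrix (Fin 5) (Fin 5) K) - of fun _ _ => 1) := by
  have h1 : IsS4Value (((Int.castRingHom K).mapMatrix
      (diagonal ![2, 2, 2, 2, -8] : Matrix (Fin 5) (Fin 5) ℤ))) :=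
    IsS4Value.map ⟨_, _, _, _, isS4Value_diagonal_int.symm⟩ _
  have h2 := (h1.smul 2⁻¹)
  refine h2.of_isConj ?_
  -- The columns of `P` are eigenvectors, and `Q` is five times its inverse.
  set P : Matrix (Fin 5) (Fin 5) ℤ :=
    !![1, 0, 0, 0, 1; 0, 1, 0, 0, 1; 0, 0, 1, 0, 1; 0, 0, 0, 1, 1; -1, -1, -1, -1, 1] with hP
  set Q : Matrix (Fin 5) (Fin 5) ℤ :=
    !![4, -1, -1, -1, -1; -1, 4, -1, -1, -1; -1, -1, 4, -1, -1; -1, -1, -1, 4, -1;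
      1, 1, 1, 1, 1] with hQ
  have hPQ : P * Q = (5 : ℤ) • 1 := by decide
  have hQP : Q * P = (5 : ℤ) • 1 := by decide
  have hQAP : Q * (2 * (1 - of fun _ _ => 1)) * P = (5 : ℤ) • diagonal ![2, 2, 2, 2, -8] := by
    decide
  let φ := (Int.castRingHom K).mapMatrix (m := Fin 5)
  have hφ : ∀ M : Matrix (Fin 5) (Fin 5) ℤ, φ ((5 : ℤ) • M) = (5 : K) • φ M := by
    intro M; ext i j
    simp only [φ, RingHom.mapMatrix_apply, map_apply, smul_apply, smul_eq_mul]
    simp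
  have h5 : (5 : K) ≠ 0 := by norm_num
  refine isConj_iff_exists.2 ⟨(5 : K)⁻¹ • φ Q, φ P, ?_, ?_, ?_⟩
  · rw [Matrix.smul_mul, ← map_mul, hQP, hφ, map_one, smul_smul, inv_mul_cancel₀ h5, one_smul]
  · rw [Matrix.mul_smul, ← map_mul, hPQ, hφ, map_one, smul_smul, inv_mul_cancel₀ h5, one_smul]
  · have h := congrArg φ hQAP
    rw [hφ, map_mul, map_mul, map_mul] at h
    have h6 : φ (1 - of fun _ _ => 1) = 1 - of fun _ _ => 1 := by
      rw [map_sub, map_one]; congr 1; ext i j; simp [φ]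
    have h7 : φ 2 = (2 : K) • 1 := by
      ext i j
      rw [map_ofNat]
      simp [ofNat_apply, one_apply]
    rw [h6, h7] at h
    simp only [Matrix.smul_mul, Matrix.mul_smul, one_mul] at h ⊢
    change (2⁻¹ : K) • φ _ = _
    rw [eq_comm, inv_smul_eq_iff₀ h5, smul_comm, ← h, smul_smul, inv_mul_cancel₀ two_ne_zero,
      one_smul]

/-- For a hollow conjugate, `u' i * φ' i = -a` for all `i`. If `a = 0`, two of the first three
indices have the same factor zero, giving a zero 2 × 2 principal block. If `a ≠ 0`, diagonal
conjugation by `u'` leads to `a` times the identity minus the all-ones matrix. -/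
theorem isS4Value_fin_five_of_rank_one {A : Matrix (Fin 5) (Fin 5) K} (hA : A.trace = 0) {a : K}
    {u φ : Fin 5 → K} (h : A = a • 1 + vecMulVec u φ) : IsS4Value A := by
  obtain ⟨B, hB, hB0⟩ := exists_isConj_isHollow A hA
  obtain ⟨P, Q, h1, -, hBA⟩ := isConj_iff_exists.1 hB
  refine IsS4Value.of_isConj ?_ hB
  have hB1 : B = a • 1 + vecMulVec (P *ᵥ u) (φ ᵥ* Q) := by
    rw [hBA, h, mul_add, add_mul, mul_vecMulVec, vecMulVec_mul]
    simp [h1]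
  generalize P *ᵥ u = u' at hB1
  generalize φ ᵥ* Q = φ' at hB1
  have hd : ∀ i, u' i * φ' i = -a := by
    intro i
    have := hB0 i
    rw [hB1] at this
    simp [vecMulVec_apply] at this
    linear_combination this
  have hod : ∀ i j, i ≠ j → B i j = u' i * φ' j := by
    intro i j hij
    rw [hB1]; simp [vecMulVec_apply, hij]
  by_cases ha : a = 0
  · have hz : ∀ i, u' i = 0 ∨ φ' i = 0 := fun i => mul_eq_zero.1 (by rw [hd, ha, neg_zero])
    have htrB := (trace_eq_of_isConj hB).trans hA
    have hu : ∀ i j, i ≠ j → u' i = 0 → u' j = 0 → IsS4Value B := fun i j hij hi hj =>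
      isS4Value_of_zero_block htrB hij (hB0 i) (by rw [hod i j hij, hi, zero_mul])
        (by rw [hod j i hij.symm, hj, zero_mul]) (hB0 j)
    have hφ : ∀ i j, i ≠ j → φ' i = 0 → φ' j = 0 → IsS4Value B := fun i j hij hi hj =>
      isS4Value_of_zero_block htrB hij (hB0 i) (by rw [hod i j hij, hj, mul_zero])
        (by rw [hod j i hij.symm, hi, mul_zero]) (hB0 j)
    have u01 := hu 0 1 (by decide)
    have u02 := hu 0 2 (by decide)
    have u12 := hu 1 2 (by decide)
    have f01 := hφ 0 1 (by decide)
    have f02 := hφ 0 2 (by decide)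
    have f12 := hφ 1 2 (by decide)
    rcases hz 0 with z0 | z0 <;> rcases hz 1 with z1 | z1 <;> rcases hz 2 with z2 | z2 <;>
    first
      | exact u01 z0 z1
      | exact u02 z0 z2
      | exact u12 z1 z2
      | exact f01 z0 z1
      | exact f02 z0 z2
      | exact f12 z1 z2
  · have hu0 : ∀ i, u' i ≠ 0 := fun i h => ha (by simpa [h] using hd i)
    refine (isS4Value_one_sub_ones.smul a).of_isConj (isConj_iff_exists.2
      ⟨diagonal fun i => (u' i)⁻¹, diagonal u', ?_, ?_, ?_⟩)
    · ext i j
      by_cases hij : i = j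
      · subst hij; simp [hu0 i]
      · simp [hij]
    · ext i j
      by_cases hij : i = j
      · subst hij; simp [hu0 i]
      · simp [hij]
    · ext i j
      rw [mul_diagonal, diagonal_mul]
      by_cases hij : i = j
      · subst hij; simp [hB0 i]
      · rw [hod i j hij]
        have := hd j
        have h1 := hu0 i
        simp [hij]
        field_simp
        linear_combination -this

theorem isS4Value_fin_five {A : Matrix (Fin 5) (Fin 5) K} (hA : A.trace = 0) : IsS4Value A := by
  obtain ⟨B, hB, hB0⟩ := exists_isConj_isHollow A hA
  refine IsS4Value.of_isConj ?_ hB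
  have htr := (trace_eq_of_isConj hB).trans hA
  clear hB hA
  by_cases hz : B = 0
  · rw [hz]; exact isS4Value_zero
  obtain ⟨i, k, hk⟩ : ∃ i k, B k i ≠ 0 := by
    by_contra! hall
    exact hz (by ext k i; exact hall i k)
  have hv : LinearIndependent K ![Pi.single i 1, toLin' B (Pi.single i 1)] := by
    rw [LinearIndependent.pair_iff' (by simp)]
    intro c hc
    have hi := congrFun hc i
    have hk' := congrFun hc k
    simp [hB0 i] at hi
    simp [hi] at hk'
    exact hk hk'.symm
  rcases LinearMap.exists_linearIndependent_or_rank_one (by simp) (toLin' B) hv with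
    ⟨v, w, hvw⟩ | ⟨a, u, hu⟩
  -- In the basis `v, B v, w, B w, x` the principal block at the positions of `v` and `w` is zero.
  · obtain ⟨x, hx⟩ := exists_linearIndependent_snoc_of_lt_finrank hvw (by simp)
    set b : Fin 5 → Fin 5 → K := Fin.snoc ![v, toLin' B v, w, toLin' B w] x with hb
    have b0 : b 0 = v := rfl
    have b1 : b 1 = B *ᵥ v := rfl
    have b2 : b 2 = w := rfl
    have b3 : b 3 = B *ᵥ w := rfl
    set P : Matrix (Fin 5) (Fin 5) K := (of b)ᵀ with hP
    have hPu : IsUnit P := linearIndependent_cols_iff_isUnit.1 hx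
    obtain ⟨p, hp⟩ := hPu
    obtain ⟨Q, hPQ, hQP⟩ : ∃ Q : Matrix (Fin 5) (Fin 5) K, P * Q = 1 ∧ Q * P = 1 :=
      ⟨↑p⁻¹, by rw [← hp, p.mul_inv], by rw [← hp, p.inv_mul]⟩
    have hcol : ∀ k l : Fin 5, b l = B *ᵥ b k → ∀ i, (Q * B * P) i k = if i = l then 1 else 0 := by
      intro k l hkl i
      have h1 : (Q * B * P) i k = (Q *ᵥ (B *ᵥ b k)) i := by
        rw [mulVec_mulVec]; rfl
      have h2 : (Q *ᵥ b l) i = (Q * P) i l := rfl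
      rw [h1, ← hkl, h2, hQP, one_apply]
    have h0 := hcol 0 1 (by rw [b0, b1])
    have h2 := hcol 2 3 (by rw [b2, b3])
    have hconj : IsConj B (Q * B * P) := isConj_iff_exists.2 ⟨Q, P, hQP, hPQ, rfl⟩
    refine IsS4Value.of_isConj (isS4Value_of_zero_block ((trace_eq_of_isConj hconj).trans htr)
      (i := 0) (j := 2) (by decide) ?_ ?_ ?_ ?_) hconj
    · rw [h0]; rfl
    · rw [h2]; rfl
    · rw [h0]; rfl
    · rw [h2]; rfl
  · choose φ hφ using fun j : Fin 5 => hu (Pi.single j 1)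
    refine isS4Value_fin_five_of_rank_one htr (a := a) (u := u) (φ := φ) ?_
    ext k l
    have := congrFun (hφ l) k
    simp [Pi.single_apply] at this
    simp [vecMulVec_apply, one_apply]
    linear_combination this

theorem isS4Value_of_trace_eq_zero {n : ℕ} (hn : 3 ≤ n) {A : Matrix (Fin n) (Fin n) K}
    (hA : A.trace = 0) : IsS4Value A := by
  induction n using Nat.strong_induction_on with
  | _ n ih =>
    obtain ⟨k, rfl⟩ := Nat.exists_eq_add_of_le hn
    obtain ⟨B, hB, hB0⟩ := exists_isConj_isHollow A hA
    refine IsS4Value.of_isConj ?_ hB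
    by_cases hk : k = 2
    · subst hk; exact isS4Value_fin_five ((trace_eq_of_isConj hB).trans hA)
    let e : Fin 3 ⊕ Fin k ≃ Fin (3 + k) := finSumFinEquiv
    refine IsS4Value.of_reindex e.symm ?_
    set C := reindex e.symm e.symm B with hC
    have hC0 : C.IsHollow := fun i => hB0 _
    have h1 : C.toBlocks₁₁.IsHollow := fun i => hC0 _
    have h2 : C.toBlocks₂₂.IsHollow := fun i => hC0 _
    rw [← fromBlocks_toBlocks C]
    refine isS4Value_fromBlocks h1.isRegularS4Value ?_ _ _
    by_cases hk1 : k ≤ 1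
    · have : C.toBlocks₂₂ = 0 := by
        ext i j
        have hij : i = j := by ext; omega
        rw [hij]; exact h2 j
      rw [this]; exact isS4Value_zero
    · exact ih k (by omega) (by omega) (by simp [trace, h2 _])

end S4

end Matrix

/-! ### Multilinear polynomials and products of commutators. -/

section Multilinear

variable {K R : Type*} [Field K] [Ring R] [Algebra K R]

/-- The value of the multilinear polynomial with coefficients `α`. -/
def multilinearValue (α : Equiv.Perm (Fin 4) → K) (a : Fin 4 → R) : R :=
  ∑ σ, α σ • (a (σ 0) * a (σ 1) * a (σ 2) * a (σ 3))

theorem multilinearValue_mul_left (α : Equiv.Perm (Fin 4) → K) (τ : Equiv.Perm (Fin 4))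
    (a : Fin 4 → R) : multilinearValue (fun σ => α (τ * σ)) (a ∘ τ) = multilinearValue α a := by
  unfold multilinearValue
  exact Equiv.sum_comp (Equiv.mulLeft τ) fun σ => α σ • (a (σ 0) * a (σ 1) * a (σ 2) * a (σ 3))

theorem map_multilinearValue {S : Type*} [Ring S] [Algebra K S] (φ : R →ₐ[K] S)
    (α : Equiv.Perm (Fin 4) → K) (a : Fin 4 → R) :
    φ (multilinearValue α a) = multilinearValue α (φ ∘ a) := by
  simp [multilinearValue, map_sum]

theorem lift_eq_multilinearValue (α : Equiv.Perm (Fin 4) → K) (a : Fin 4 → R) :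
    FreeAlgebra.lift K a (∑ σ : Equiv.Perm (Fin 4),
      α σ • (List.ofFn fun i => FreeAlgebra.ι K (σ i)).prod) = multilinearValue α a := by
  simp [multilinearValue, map_sum, List.ofFn_succ, mul_assoc]

/-- Representatives of the cosets of the group generated by the transpositions of the first two and
of the last two positions. -/
def cosetRep : Fin 6 → Equiv.Perm (Fin 4) :=
  ![1, ⟨![2, 3, 0, 1], ![2, 3, 0, 1], by decide, by decide⟩,
    ⟨![0, 2, 1, 3], ![0, 2, 1, 3], by decide, by decide⟩,
    ⟨![1, 3, 0, 2], ![2, 0, 3, 1], by decide, by decide⟩,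
    ⟨![0, 3, 1, 2], ![0, 2, 3, 1], by decide, by decide⟩,
    ⟨![1, 2, 0, 3], ![2, 0, 1, 3], by decide, by decide⟩]

theorem cosetRep_bijective : Function.Bijective fun p : Fin 6 × Fin 2 × Fin 2 =>
    cosetRep p.1 * (Equiv.swap 0 1) ^ (p.2.1 : ℕ) * (Equiv.swap 2 3) ^ (p.2.2 : ℕ) := by
  rw [Fintype.bijective_iff_injective_and_card]
  exact ⟨by decide, by decide⟩

theorem multilinearValue_of_antisymm {α : Equiv.Perm (Fin 4) → K}
    (h1 : ∀ σ, α (σ * Equiv.swap 0 1) = -α σ) (h2 : ∀ σ, α (σ * Equiv.swap 2 3) = -α σ)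
    (a : Fin 4 → R) : multilinearValue α a =
      ∑ r, α (cosetRep r) • (⁅a (cosetRep r 0), a (cosetRep r 1)⁆ *
        ⁅a (cosetRep r 2), a (cosetRep r 3)⁆) := by
  unfold multilinearValue
  rw [← cosetRep_bijective.sum_comp, Fintype.sum_prod_type]
  refine Finset.sum_congr rfl fun r _ => ?_
  have e1 : Equiv.swap (0 : Fin 4) 1 2 = 2 := by decide
  have e2 : Equiv.swap (0 : Fin 4) 1 3 = 3 := by decide
  have e3 : Equiv.swap (2 : Fin 4) 3 0 = 0 := by decide
  have e4 : Equiv.swap (2 : Fin 4) 3 1 = 1 := by decide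
  simp only [Fintype.sum_prod_type, Fin.sum_univ_two, Fin.val_zero, Fin.val_one, pow_zero, pow_one,
    mul_one, h1, h2, Equiv.Perm.mul_apply, Equiv.swap_apply_left, Equiv.swap_apply_right, e1, e2,
    e3, e4, Ring.lie_def, Equiv.Perm.coe_one, id]
  simp only [mul_sub, sub_mul, smul_sub, mul_assoc]
  module

end Multilinear

namespace Matrix

/-! ### Coefficients without antisymmetry. -/

section Easy

variable {K ι : Type*} [Field K] [Fintype ι] [DecidableEq ι]

/-- The factor by which the monomial of `σ` multiplies the `(i, j)` entry of the variable `1` when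
the other variables are diagonal matrices, with entries `u` in place `i` and `v` in place `j`. -/
def diagonalFactor {S : Type*} [CommMonoid S] (u v : Fin 4 → S) (σ : Equiv.Perm (Fin 4)) : S :=
  ∏ l, if σ l = 1 then 1 else if l < σ⁻¹ 1 then u (σ l) else v (σ l)

theorem map_diagonalFactor {S T F : Type*} [CommMonoid S] [CommMonoid T] [FunLike F S T]
    [MonoidHomClass F S T] (φ : F) (u v : Fin 4 → S) (σ : Equiv.Perm (Fin 4)) :
    φ (diagonalFactor u v σ) = diagonalFactor (φ ∘ u) (φ ∘ v) σ := by
  simp only [diagonalFactor, map_prod]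
  refine Finset.prod_congr rfl fun l _ => ?_
  split_ifs <;> simp

theorem diagonalFactor_indicator (σ : Equiv.Perm (Fin 4)) :
    diagonalFactor ![1, 0, 0, 0] ![0, 0, 1, 1] σ =
      if σ = 1 ∨ σ = Equiv.swap 2 3 then (1 : ℕ) else 0 := by
  revert σ
  decide

theorem monomial_diagonal_apply (X : Matrix ι ι K) (d : Fin 4 → ι → K) (σ : Equiv.Perm (Fin 4))
    (i j : ι) {a : Fin 4 → Matrix ι ι K} (ha : ∀ m, a m = if m = 1 then X else diagonal (d m)) :
    (a (σ 0) * a (σ 1) * a (σ 2) * a (σ 3)) i j =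
      diagonalFactor (d · i) (d · j) σ * X i j := by
  obtain ⟨k, hk⟩ : ∃ k, σ k = 1 := ⟨σ⁻¹ 1, by simp⟩
  have hk' : σ⁻¹ 1 = k := by rw [← hk]; simp
  have hne : ∀ l, l ≠ k → σ l ≠ 1 := fun l hl h => hl (σ.injective (h.trans hk.symm))
  simp only [diagonalFactor, hk', Fin.prod_univ_four, ha]
  fin_cases k
  · have h1 := hne 1 (by decide)
    have h2 := hne 2 (by decide)
    have h3 := hne 3 (by decide)
    simp at hk
    simp only [hk, h1, h2, h3, if_true, if_false, mul_diagonal, diagonal_mul_diagonal,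
      lt_self_iff_false, Fin.zero_eta, Fin.isValue, not_lt_zero, mul_assoc]
    ring
  · have h1 := hne 0 (by decide)
    have h2 := hne 2 (by decide)
    have h3 := hne 3 (by decide)
    simp at hk
    simp only [hk, h1, h2, h3, if_true, if_false, mul_diagonal, diagonal_mul, lt_self_iff_false,
      Fin.reduceLT, Fin.mk_one, Fin.isValue, mul_assoc]
    ring
  · have h1 := hne 0 (by decide)
    have h2 := hne 1 (by decide)
    have h3 := hne 3 (by decide)
    simp at hk
    simp only [hk, h1, h2, h3, if_true, if_false, mul_diagonal, diagonal_mul,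
      diagonal_mul_diagonal, lt_self_iff_false, Fin.reduceFinMk, Fin.reduceLT, Fin.isValue,
      mul_assoc]
    ring
  · have h1 := hne 0 (by decide)
    have h2 := hne 1 (by decide)
    have h3 := hne 2 (by decide)
    simp at hk
    simp [hk, h1, h2, h3, mul_assoc]

/-- For generic diagonal entries all off-diagonal factors `p i j` are nonzero at once, and `B` is
divided by them entrywise. -/
theorem exists_multilinearValue_eq_of_isHollow [Infinite K] {α : Equiv.Perm (Fin 4) → K}
    (hα : α 1 + α (Equiv.swap 2 3) ≠ 0) {B : Matrix ι ι K} (hB : B.IsHollow) :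
    ∃ a, multilinearValue α a = B := by
  let p : ι → ι → MvPolynomial (Fin 4 × ι) K := fun i j =>
    ∑ σ, MvPolynomial.C (α σ) *
      diagonalFactor (fun m => MvPolynomial.X (m, i)) (fun m => MvPolynomial.X (m, j)) σ
  have hp (e : Fin 4 × ι → K) (i j : ι) : MvPolynomial.eval e (p i j) =
      ∑ σ, α σ * diagonalFactor (fun m => e (m, i)) (fun m => e (m, j)) σ := by
    simp only [p, map_sum, map_mul, MvPolynomial.eval_C, map_diagonalFactor]
    simp [Function.comp_def]
  have hne (i j : ι) (hij : i ≠ j) : p i j ≠ 0 := by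
    intro h
    -- At this point only the monomials with variable 0 before variable 1, and variables 2 and 3
    -- after it, survive. The entries at index 1 play no role.
    let u : Fin 4 → ℕ := ![1, 0, 0, 0]
    let v : Fin 4 → ℕ := ![0, 0, 1, 1]
    have h0 := hp (fun q => if q.2 = i then (u q.1 : K) else (v q.1 : K)) i j
    have hcast (σ : Equiv.Perm (Fin 4)) : diagonalFactor (fun m => (u m : K)) (fun m => (v m : K)) σ
        = if σ = 1 ∨ σ = Equiv.swap 2 3 then 1 else 0 := by
      have := map_diagonalFactor (Nat.castRingHom K) u v σ
      rw [diagonalFactor_indicator] at this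
      simpa [Function.comp_def, apply_ite] using this.symm
    simp only [h, map_zero, if_true, hij.symm, if_false, hcast, mul_ite, mul_one, mul_zero] at h0
    rw [← Finset.sum_filter, show (Finset.univ.filter fun σ : Equiv.Perm (Fin 4) =>
      σ = 1 ∨ σ = Equiv.swap 2 3) = {1, Equiv.swap 2 3} by ext; simp,
      Finset.sum_pair (by decide)] at h0
    exact hα h0.symm
  have hprod : (∏ q : ι × ι, if q.1 = q.2 then 1 else p q.1 q.2) ≠ 0 := by
    refine Finset.prod_ne_zero_iff.mpr fun q _ => ?_
    split_ifs with h
    · exact one_ne_zero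
    · exact hne _ _ h
  obtain ⟨e, he⟩ : ∃ e, MvPolynomial.eval e (∏ q : ι × ι, if q.1 = q.2 then 1 else p q.1 q.2) ≠ 0 := by
    by_contra! hall
    exact hprod (MvPolynomial.funext fun e => by rw [hall, map_zero])
  rw [map_prod, Finset.prod_ne_zero_iff] at he
  let X : Matrix ι ι K := of fun i j => B i j / MvPolynomial.eval e (p i j)
  refine ⟨fun m => if m = 1 then X else diagonal fun i => e (m, i), ?_⟩
  ext i j
  simp only [multilinearValue, sum_apply, smul_apply, smul_eq_mul]
  rw [Finset.sum_congr rfl fun σ _ => by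
    rw [monomial_diagonal_apply X (fun m i => e (m, i)) σ i j fun _ => rfl, ← mul_assoc],
    ← Finset.sum_mul, ← hp]
  by_cases hij : i = j
  · subst hij
    simp [X, hB i]
  · have := he (i, j) (Finset.mem_univ _)
    simp only [hij, if_false] at this
    simp only [X, of_apply]
    exact mul_div_cancel₀ _ this

end Easy

/-! ### Assembling the cases. -/

section Image

variable {K : Type*} [Field K]

theorem exists_multilinearValue_eq_of_add_swap_ne_zero [CharZero K] {n : ℕ}
    {α : Equiv.Perm (Fin 4) → K} {σ : Equiv.Perm (Fin 4)}
    (hα : α σ + α (σ * Equiv.swap 2 3) ≠ 0) {A : Matrix (Fin n) (Fin n) K} (hA : A.trace = 0) :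
    ∃ a, multilinearValue α a = A := by
  obtain ⟨B, hAB, hB⟩ := exists_isConj_isHollow A hA
  obtain ⟨φ, rfl⟩ := exists_algHom_of_isConj hAB
  obtain ⟨a, rfl⟩ := exists_multilinearValue_eq_of_isHollow (α := fun τ => α (σ * τ))
    (by simpa using hα) hB
  refine ⟨φ ∘ a ∘ ⇑σ⁻¹, ?_⟩
  rw [← map_multilinearValue, ← multilinearValue_mul_left α σ]
  congr 2
  ext1 m
  simp

theorem transpose_multilinearValue {ι : Type*} [Fintype ι] [DecidableEq ι]
    (α : Equiv.Perm (Fin 4) → K) (a : Fin 4 → Matrix ι ι K) :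
    (multilinearValue (fun σ => α (σ * Fin.revPerm)) a)ᵀ =
      multilinearValue α fun m => (a m)ᵀ := by
  unfold multilinearValue
  rw [← Equiv.sum_comp (Equiv.mulRight (Fin.revPerm : Equiv.Perm (Fin 4))), transpose_sum]
  refine Finset.sum_congr rfl fun σ _ => ?_
  have e0 : Fin.rev (0 : Fin 4) = 3 := rfl
  have e1 : Fin.rev (1 : Fin 4) = 2 := rfl
  have e2 : Fin.rev (2 : Fin 4) = 1 := rfl
  have e3 : Fin.rev (3 : Fin 4) = 0 := rfl
  have hrev : (Fin.revPerm : Equiv.Perm (Fin 4)) * Fin.revPerm = 1 := by decide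
  simp [e0, e1, e2, e3, hrev, mul_assoc]

/-- Transposition reverses monomials and so exchanges the first two positions with the last two. -/
theorem exists_multilinearValue_eq_of_add_swap_ne_zero_left [CharZero K] {n : ℕ}
    {α : Equiv.Perm (Fin 4) → K} {σ : Equiv.Perm (Fin 4)}
    (hα : α σ + α (σ * Equiv.swap 0 1) ≠ 0) {A : Matrix (Fin n) (Fin n) K} (hA : A.trace = 0) :
    ∃ a, multilinearValue α a = A := by
  have hrev : Equiv.swap 2 3 * Fin.revPerm = Fin.revPerm * Equiv.swap (0 : Fin 4) 1 := by decide
  have hrev' : (Fin.revPerm : Equiv.Perm (Fin 4)) * Fin.revPerm = 1 := by decide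
  obtain ⟨a, ha⟩ := exists_multilinearValue_eq_of_add_swap_ne_zero
    (α := fun τ => α (τ * Fin.revPerm)) (σ := σ * Fin.revPerm)
    (by simpa only [mul_assoc, hrev, hrev', ← mul_assoc Fin.revPerm Fin.revPerm, mul_one, one_mul]
      using hα)
    (A := Aᵀ) (by rwa [trace_transpose])
  exact ⟨_, by rw [← transpose_multilinearValue, ha, transpose_transpose]⟩

theorem exists_smul_lie_mul_lie_add_eq [IsAlgClosed K] [CharZero K] {m : ℕ} {s t : K}
    (hst : s ≠ 0 ∨ t ≠ 0) {A : Matrix (Fin (m + 3)) (Fin (m + 3)) K} (hA : A.trace = 0) :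
    ∃ x y z : Matrix (Fin (m + 3)) (Fin (m + 3)) K,
      s • (⁅x, y⁆ * ⁅x, z⁆) + t • (⁅x, z⁆ * ⁅x, y⁆) = A := by
  wlog hs : s ≠ 0 generalizing s t
  · obtain ⟨x, y, z, h⟩ := this hst.symm (hst.resolve_left hs)
    exact ⟨x, z, y, h ▸ add_comm _ _⟩
  obtain ⟨x, y, z, h⟩ := isTwistedValue_of_trace_eq_zero (-(t / s)) (A := s⁻¹ • A)
    (by rw [trace_smul, hA, smul_zero])
  refine ⟨x, y, z, ?_⟩
  rw [inv_smul_eq_iff₀ hs] at h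
  rw [h, neg_smul, sub_neg_eq_add, smul_add, smul_smul, mul_div_cancel₀ _ hs]

theorem exists_multilinearValue_eq_of_antisymm [IsAlgClosed K] [CharZero K] {m : ℕ}
    {α : Equiv.Perm (Fin 4) → K} (hα : α ≠ 0) (h1 : ∀ σ, α (σ * Equiv.swap 0 1) = -α σ)
    (h2 : ∀ σ, α (σ * Equiv.swap 2 3) = -α σ) {A : Matrix (Fin (m + 3)) (Fin (m + 3)) K}
    (hA : A.trace = 0) : ∃ a, multilinearValue α a = A := by
  obtain ⟨r, hr⟩ : ∃ r, α (cosetRep r) ≠ 0 := by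
    by_contra! h
    refine hα (funext fun σ => ?_)
    obtain ⟨⟨r, i, j⟩, rfl⟩ := cosetRep_bijective.surjective σ
    fin_cases i <;> fin_cases j <;> simp [h1, h2, h]
  have key (x : Fin 4 → Matrix (Fin (m + 3)) (Fin (m + 3)) K) : multilinearValue α x =
      α (cosetRep 0) • (⁅x 0, x 1⁆ * ⁅x 2, x 3⁆) + α (cosetRep 1) • (⁅x 2, x 3⁆ * ⁅x 0, x 1⁆) +
      α (cosetRep 2) • (⁅x 0, x 2⁆ * ⁅x 1, x 3⁆) + α (cosetRep 3) • (⁅x 1, x 3⁆ * ⁅x 0, x 2⁆) +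
      α (cosetRep 4) • (⁅x 0, x 3⁆ * ⁅x 1, x 2⁆) +
      α (cosetRep 5) • (⁅x 1, x 2⁆ * ⁅x 0, x 3⁆) := by
    rw [multilinearValue_of_antisymm h1 h2, Fin.sum_univ_six]
    rfl
  replace hr : ¬ ∀ r, α (cosetRep r) = 0 := fun h => hr (h r)
  simp only [Fin.forall_fin_succ, Fin.succ_zero_eq_one, IsEmpty.forall_iff, and_true] at hr
  generalize α (cosetRep 0) = a₁ at key hr
  generalize α (cosetRep 1) = a₂ at key hr
  generalize hb₁ : α (cosetRep 2) = b₁ at key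
  generalize hb₂ : α (cosetRep 3) = b₂ at key
  generalize hc₁ : α (cosetRep 4) = c₁ at key
  generalize hc₂ : α (cosetRep 5) = c₂ at key
  change ¬ (a₁ = 0 ∧ a₂ = 0 ∧ α (cosetRep 2) = 0 ∧ α (cosetRep 3) = 0 ∧ α (cosetRep 4) = 0 ∧
    α (cosetRep 5) = 0) at hr
  rw [hb₁, hb₂, hc₁, hc₂] at hr
  have hself (x : Matrix (Fin (m + 3)) (Fin (m + 3)) K) : ⁅x, x⁆ = 0 := by
    rw [Ring.lie_def, sub_self]
  have hskew (x y : Matrix (Fin (m + 3)) (Fin (m + 3)) K) : ⁅x, y⁆ = -⁅y, x⁆ := by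
    rw [Ring.lie_def, Ring.lie_def, neg_sub]
  by_cases e1 : b₁ + c₂ ≠ 0 ∨ b₂ + c₁ ≠ 0
  · obtain ⟨x, y, z, rfl⟩ := exists_smul_lie_mul_lie_add_eq e1 hA
    refine ⟨![x, x, y, z], (key _).trans ?_⟩
    simp only [cons_val, hself, zero_mul, mul_zero, smul_zero]
    module
  by_cases e2 : b₁ + c₁ ≠ 0 ∨ b₂ + c₂ ≠ 0
  · obtain ⟨x, y, z, rfl⟩ := exists_smul_lie_mul_lie_add_eq e2 hA
    refine ⟨![y, z, x, x], (key _).trans ?_⟩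
    simp only [cons_val, hself, zero_mul, mul_zero, smul_zero, hskew y x, hskew z x,
      neg_mul_neg]
    module
  by_cases e3 : a₁ - c₂ ≠ 0 ∨ a₂ - c₁ ≠ 0
  · obtain ⟨x, y, z, rfl⟩ := exists_smul_lie_mul_lie_add_eq e3 hA
    refine ⟨![x, y, x, z], (key _).trans ?_⟩
    simp only [cons_val, hself, zero_mul, mul_zero, smul_zero, hskew y x, neg_mul, mul_neg]
    module
  by_cases e4 : a₁ - c₁ ≠ 0 ∨ a₂ - c₂ ≠ 0
  · obtain ⟨x, y, z, rfl⟩ := exists_smul_lie_mul_lie_add_eq e4 hA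
    refine ⟨![y, x, z, x], (key _).trans ?_⟩
    simp only [cons_val, hself, zero_mul, mul_zero, smul_zero, hskew y x, hskew z x,
      neg_mul, mul_neg, neg_neg]
    module
  -- All four identifications vanish, which leaves `-b₂` times `s4`.
  push Not at e1 e2 e3 e4
  obtain rfl : c₂ = -b₁ := by linear_combination e1.1
  obtain rfl : c₁ = -b₁ := by linear_combination e2.1
  obtain rfl : b₂ = b₁ := by linear_combination e1.2
  obtain rfl : a₁ = -b₂ := by linear_combination e3.1
  obtain rfl : a₂ = -b₂ := by linear_combination e3.2
  have hb : -b₂ ≠ 0 := fun h => hr (by simp [neg_eq_zero.mp h])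
  obtain ⟨a, b, c, d, h⟩ := isS4Value_of_trace_eq_zero (A := (-b₂)⁻¹ • A) (by omega)
    (by rw [trace_smul, hA, smul_zero])
  rw [inv_smul_eq_iff₀ hb] at h
  refine ⟨![a, b, c, d], (key _).trans ?_⟩
  rw [h, s4]
  simp only [cons_val]
  module

theorem exists_multilinearValue_eq [IsAlgClosed K] [CharZero K] {n : ℕ} (hn : 3 ≤ n)
    {α : Equiv.Perm (Fin 4) → K} (hα : α ≠ 0) {A : Matrix (Fin n) (Fin n) K} (hA : A.trace = 0) :
    ∃ a, multilinearValue α a = A := by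
  obtain ⟨m, rfl⟩ := Nat.exists_eq_add_of_le' hn
  by_cases h1 : ∀ σ, α σ + α (σ * Equiv.swap 0 1) = 0
  · by_cases h2 : ∀ σ, α σ + α (σ * Equiv.swap 2 3) = 0
    · exact exists_multilinearValue_eq_of_antisymm hα
        (fun σ => eq_neg_of_add_eq_zero_right (h1 σ)) (fun σ => eq_neg_of_add_eq_zero_right (h2 σ)) hA
    · push Not at h2
      exact exists_multilinearValue_eq_of_add_swap_ne_zero h2.choose_spec hA
  · push Not at h1
    exact exists_multilinearValue_eq_of_add_swap_ne_zero_left h1.choose_spec hA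

end Image

end Matrix

theorem theorem4p1 {K : Type*} [Field K] [IsAlgClosed K] [CharZero K] (n : ℕ) (hn : 3 ≤ n)
    (f : FreeAlgebra K (Fin 4)) (hf : IsMultilinearPoly f) (hf0 : f ≠ 0) :
    (LieAlgebra.SpecialLinear.sl (Fin n) K : Set (Matrix (Fin n) (Fin n) K)) ⊆
      polyImage f (Matrix (Fin n) (Fin n) K) := by
  obtain ⟨α, rfl⟩ := hf
  intro A hA
  have hα : α ≠ 0 := by
    rintro rfl
    simp at hf0
  obtain ⟨a, ha⟩ := exists_multilinearValue_eq hn hα (A := A) hA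
  exact ⟨a, (lift_eq_multilinearValue α a).trans ha⟩
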